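/- **Theorem (EMSPE Reduction).** Let $\sigma>0$ and $\rho\in[-1,1]$. Consider $n_a$ training units (superscript $a$) and $n_b\ge 1$ test units (superscript $b$), with $d\ge 1$ covariates, and the pre-recourse and post-recourse linear models $$Y_0 = X_0\beta_0+\varepsilon_0,\qquad Y = X\beta+\varepsilon,\qquad \varepsilon=\rho\,\varepsilon_0+\sqrt{1-\rho^2}\,\bar\varepsilon ,$$ where $\beta_0,\beta\in\mathbb R^d$; over all $n_a+n_b$ units the pairs of rows $(X_{0,i},X_i)\in\mathbb R^d\times\mathbb R^d$ are i.i.d. jointly Gaussian (a possibly degenerate joint law, not necessarily centred) with $\mathbb E[X_{0,i}X_{0,i}^\top]=\Sigma_0\succ0$ and $\mathbb E[X_iX_i^\top]=\Sigma\succ0$; $\varepsilon_0\sim N(0,\sigma^2 I)$ and $\bar\varepsilon\sim N(0,\sigma^2I)$ are independent of each other, and $(\varepsilon_0,\bar\varepsilon)$ is independent of all covariates. Define the two-stage OLS estimator on the training data by $$\hat\beta_0=(X_0^{a\top}X_0^a)^{-1}X_0^{a\top}Y_0^a,\quad \hat\varepsilon_0^a=Y_0^a-X_0^a\hat\beta_0,\quad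 \mathbf X^a=(X^a\;\;\hat\varepsilon_0^a),\quad \hat\beta_c=(\mathbf X^{a\top}\mathbf X^a)^{-1}\mathbf X^{a\top}Y^a,$$ and the single-stage OLS estimator by $\hat\beta=(X^{a\top}X^a)^{-1}X^{a\top}Y^a$. On the test data put $\hat\varepsilon_0^b=Y_0^b-X_0^b\hat\beta_0$ and $\mathbf X^b=(X^b\;\;\hat\varepsilon_0^b)$. With $\mathcal D_{\mathrm{tr}}=\{X_0^a,X^a,\varepsilon_0^a,\bar\varepsilon^a\}$ let $$R_{\mathrm{aug}}=\frac1{n_b}\mathbb E\bigl[\|Y^b-\mathbf X^b\hat\beta_c\|^2\,\big|\,\mathcal D_{\mathrm{tr}}\bigr],\qquad R_{\mathrm{std}}=\frac1{n_b}\mathbb E\bigl[\|Y^b-X^b\hat\beta\|^2\,\big|\,\mathcal D_{\mathrm{tr}}\bigr].$$ Then, in the regime $n_a\gg d$ (that is, $n_a/d\to\infty$, where $d$ may be fixed or vary), $$R_{\mathrm{aug}}=(1-\rho^2)\sigma^2+O_p\!\left(\sqrt{\tfrac d{n_a}}\right),\qquad R_{\mathrm{std}}=\sigma^2+O_p\!\left(\tfrac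 d{n_a}\right),$$ and, if $\rho\neq0$, $R_{\mathrm{aug}}<R_{\mathrm{std}}$ with probability tending to $1$. Here, for fixed $\sigma,\rho$, the statements hold uniformly over $d,n_b,\beta_0,\beta$ and the law of the covariates: $Z=O_p(r)$ means that for every $\delta>0$ there are $C,K$, depending only on $\delta,\sigma,\rho$, such that $\mathbb P(|Z|>C\,r)\le\delta$ in every such model with $n_a\ge K d$; and the last claim means that for every $\delta>0$ there is $K$, depending only on $\delta,\sigma,\rho$, with $\mathbb P(R_{\mathrm{aug}}<R_{\mathrm{std}})\ge1-\delta$ in every such model with $n_a\ge K d$. -/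

import Mathlib

open MeasureTheory ProbabilityTheory Filter Topology
open scoped Matrix

noncomputable section

namespace LinearRecourse

/-- Boundedness in probability, `Z = O_p(r)` along the filter `l`: for every `δ > 0` there is a
constant `C` with `P i (|Z i| > C * r i) ≤ δ` for all `i` eventually along `l`. The random
variables `Z i` may live on different probability spaces. -/
def IsBigOp {ι : Type*} (l : Filter ι) {Ω : ι → Type*} [∀ i, MeasurableSpace (Ω i)]
    (P : ∀ i, Measure (Ω i)) (Z : ∀ i, Ω i → ℝ) (r : ι → ℝ) : Prop :=
  ∀ δ : ℝ, 0 < δ → ∃ C : ℝ, ∀ᶠ i in l, (P i).real {ω | C * r i < |Z i ω|} ≤ δ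

/-- The ordinary least squares coefficient `(Aᵀ A)⁻¹ Aᵀ y` of the regression of `y` on the
columns of `A`. -/
def ols {m k : Type*} [Fintype m] [Fintype k] [DecidableEq k]
    (A : Matrix m k ℝ) (y : m → ℝ) : k → ℝ :=
  (Aᵀ * A)⁻¹ *ᵥ (Aᵀ *ᵥ y)

/-- The matrix `(A  r)`, i.e. `A` with the vector `r` appended as one more column. -/
def appendCol {m k : Type*} (A : Matrix m k ℝ) (r : m → ℝ) : Matrix m (k ⊕ Unit) ℝ :=
  Matrix.fromCols A (Matrix.replicateCol Unit r)

/-- A sample of `n` units: the tuple `(X₀, X, ε₀, ε̄)`, where row `i` of `X₀` and of `X` holds the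
pre- and post-recourse covariates of unit `i`. -/
abbrev Sample (d n : ℕ) : Type :=
  (Fin n → Fin d → ℝ) × (Fin n → Fin d → ℝ) × (Fin n → ℝ) × (Fin n → ℝ)

instance (d n : ℕ) : StandardBorelSpace (Sample d n) := by
  have : StandardBorelSpace (Fin d → ℝ) := StandardBorelSpace.pi_countable
  have : StandardBorelSpace (Fin n → ℝ) := StandardBorelSpace.pi_countable
  have : StandardBorelSpace (Fin n → Fin d → ℝ) := StandardBorelSpace.pi_countable
  have : StandardBorelSpace ((Fin n → ℝ) × (Fin n → ℝ)) := StandardBorelSpace.prod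
  have : StandardBorelSpace ((Fin n → Fin d → ℝ) × (Fin n → ℝ) × (Fin n → ℝ)) :=
    StandardBorelSpace.prod
  exact StandardBorelSpace.prod

namespace Sample

variable {d n : ℕ}

/-- Pre-recourse design matrix `X₀`. -/
def X0 (s : Sample d n) : Matrix (Fin n) (Fin d) ℝ := Matrix.of s.1

/-- Post-recourse design matrix `X`. -/
def X (s : Sample d n) : Matrix (Fin n) (Fin d) ℝ := Matrix.of s.2.1

/-- Pre-recourse noise `ε₀`. -/
def eps0 (s : Sample d n) : Fin n → ℝ := s.2.2.1

/-- The noise component `ε̄`. -/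
def epsBar (s : Sample d n) : Fin n → ℝ := s.2.2.2

/-- Post-recourse noise `ε = ρ ε₀ + √(1 - ρ²) ε̄`. -/
def eps (ρ : ℝ) (s : Sample d n) : Fin n → ℝ := ρ • s.eps0 + √(1 - ρ ^ 2) • s.epsBar

/-- Pre-recourse outcome `Y₀ = X₀ β₀ + ε₀`. -/
def Y0 (β0 : Fin d → ℝ) (s : Sample d n) : Fin n → ℝ := s.X0 *ᵥ β0 + s.eps0

/-- Post-recourse outcome `Y = X β + ε`. -/
def Y (ρ : ℝ) (β : Fin d → ℝ) (s : Sample d n) : Fin n → ℝ := s.X *ᵥ β + s.eps ρ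

/-- Stage I: OLS regression of `Y₀` on `X₀`. -/
def betaHat0 (β0 : Fin d → ℝ) (s : Sample d n) : Fin d → ℝ := ols s.X0 (s.Y0 β0)

/-- The augmented design matrix `(X  Y₀ - X₀ b)`, for a pre-recourse coefficient estimate `b`. -/
def augDesign (β0 b : Fin d → ℝ) (s : Sample d n) : Matrix (Fin n) (Fin d ⊕ Unit) ℝ :=
  appendCol s.X (s.Y0 β0 - s.X0 *ᵥ b)

/-- Stage II: OLS regression of `Y` on `X` and the Stage I residuals. -/
def betaHatC (ρ : ℝ) (β0 β : Fin d → ℝ) (s : Sample d n) : Fin d ⊕ Unit → ℝ :=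
  ols (s.augDesign β0 (s.betaHat0 β0)) (s.Y ρ β)

/-- Single-stage OLS regression of `Y` on `X`. -/
def betaHat (ρ : ℝ) (β : Fin d → ℝ) (s : Sample d n) : Fin d → ℝ := ols s.X (s.Y ρ β)

/-- `(1 / n_b) ‖Y^b - 𝐗^b β̂_c‖²`, where the coefficients are fitted on the training sample `a` and
the test residuals `Y₀^b - X₀^b β̂₀` use the Stage I coefficient fitted on `a`. -/
def lossAug {na nb : ℕ} (ρ : ℝ) (β0 β : Fin d → ℝ) (a : Sample d na) (b : Sample d nb) : ℝ :=
  (1 / (nb : ℝ)) *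
    ∑ j, (b.Y ρ β j - (b.augDesign β0 (a.betaHat0 β0) *ᵥ a.betaHatC ρ β0 β) j) ^ 2

/-- `(1 / n_b) ‖Y^b - X^b β̂‖²`, with `β̂` fitted on the training sample `a`. -/
def lossStd {na nb : ℕ} (ρ : ℝ) (β : Fin d → ℝ) (a : Sample d na) (b : Sample d nb) : ℝ :=
  (1 / (nb : ℝ)) * ∑ j, (b.Y ρ β j - (b.X *ᵥ a.betaHat ρ β) j) ^ 2

end Sample

/-- A linear Gaussian model, before and after recourse, with noise variance `σ²` and noise correlation `ρ`,
observed on `na` training units (`Sum.inl`) and `nb` test units (`Sum.inr`). -/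
structure Model (σ ρ : ℝ) where
  /-- number of covariates -/
  d : ℕ
  /-- number of training units -/
  na : ℕ
  /-- number of test units -/
  nb : ℕ
  d_pos : 0 < d
  nb_pos : 0 < nb
  /-- the underlying probability space -/
  Ω : Type*
  [mΩ : MeasurableSpace Ω]
  P : Measure Ω
  [prob : IsProbabilityMeasure P]
  /-- pre-recourse coefficients -/
  β0 : Fin d → ℝ
  /-- post-recourse coefficients -/
  β : Fin d → ℝ
  /-- second moment matrix of the pre-recourse covariates -/
  S0 : Matrix (Fin d) (Fin d) ℝ
  /-- second moment matrix of the post-recourse covariates -/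
  S : Matrix (Fin d) (Fin d) ℝ
  /-- pre-recourse covariates of each unit -/
  X0 : Fin na ⊕ Fin nb → Ω → Fin d → ℝ
  /-- post-recourse covariates of each unit -/
  X : Fin na ⊕ Fin nb → Ω → Fin d → ℝ
  eps0 : Fin na ⊕ Fin nb → Ω → ℝ
  epsBar : Fin na ⊕ Fin nb → Ω → ℝ
  measurable_X0 : ∀ i, Measurable (X0 i)
  measurable_X : ∀ i, Measurable (X i)
  measurable_eps0 : ∀ i, Measurable (eps0 i)
  measurable_epsBar : ∀ i, Measurable (epsBar i)
  /-- the pairs `(X₀ᵢ, Xᵢ)` are jointly Gaussian (not necessarily centred or nondegenerate) -/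
  gaussian_cov : ∀ i, HasGaussianLaw (fun ω => (X0 i ω, X i ω)) P
  indep_cov : iIndepFun (fun i ω => (X0 i ω, X i ω)) P
  identDistrib_cov :
    ∀ i j, IdentDistrib (fun ω => (X0 i ω, X i ω)) (fun ω => (X0 j ω, X j ω)) P P
  secondMoment_X0 : ∀ i k l, ∫ ω, X0 i ω k * X0 i ω l ∂P = S0 k l
  secondMoment_X : ∀ i k l, ∫ ω, X i ω k * X i ω l ∂P = S k l
  posDef_S0 : S0.PosDef
  posDef_S : S.PosDef
  /-- `ε₀ ∼ N(0, σ² I)` -/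
  law_eps0 : HasLaw (fun ω i => eps0 i ω)
    (Measure.pi fun _ : Fin na ⊕ Fin nb => gaussianReal 0 (σ ^ 2).toNNReal) P
  /-- `ε̄ ∼ N(0, σ² I)` -/
  law_epsBar : HasLaw (fun ω i => epsBar i ω)
    (Measure.pi fun _ : Fin na ⊕ Fin nb => gaussianReal 0 (σ ^ 2).toNNReal) P
  indep_noise : IndepFun (fun ω i => eps0 i ω) (fun ω i => epsBar i ω) P
  /-- the noise is independent of the covariates -/
  indep_cov_noise : IndepFun (fun ω i => (X0 i ω, X i ω))
    (fun ω => ((fun i => eps0 i ω), (fun i => epsBar i ω))) P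

namespace Model

variable {σ ρ : ℝ}

instance (M : Model σ ρ) : MeasurableSpace M.Ω := M.mΩ

instance (M : Model σ ρ) : IsProbabilityMeasure M.P := M.prob

/-- The training data `(X₀^a, X^a, ε₀^a, ε̄^a)`. -/
def train (M : Model σ ρ) (ω : M.Ω) : Sample M.d M.na :=
  (fun i => M.X0 (.inl i) ω, fun i => M.X (.inl i) ω,
    fun i => M.eps0 (.inl i) ω, fun i => M.epsBar (.inl i) ω)

/-- The test data `(X₀^b, X^b, ε₀^b, ε̄^b)`. -/
def test (M : Model σ ρ) (ω : M.Ω) : Sample M.d M.nb :=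
  (fun j => M.X0 (.inr j) ω, fun j => M.X (.inr j) ω,
    fun j => M.eps0 (.inr j) ω, fun j => M.epsBar (.inr j) ω)

/-- The conditional expectation of `loss (training data) (test data)` given the training data:
the integral of the loss against the regular conditional distribution of the test data. -/
def condRisk (M : Model σ ρ) (loss : Sample M.d M.na → Sample M.d M.nb → ℝ) (ω : M.Ω) : ℝ :=
  ∫ b, loss (M.train ω) b ∂(condDistrib M.test M.train M.P (M.train ω))

/-- `R_aug`, the conditional test prediction risk of the two-stage OLS estimator. -/
def riskAug (M : Model σ ρ) : M.Ω → ℝ := M.condRisk (Sample.lossAug ρ M.β0 M.β)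

/-- `R_std`, the conditional test prediction risk of the single-stage OLS estimator. -/
def riskStd (M : Model σ ρ) : M.Ω → ℝ := M.condRisk (Sample.lossStd ρ M.β)

/-- The regime `n_a ≫ d`: a property holds eventually along this filter if there is `K` such that
it holds for all models with `n_a ≥ K * d`. -/
def manySamples (σ ρ : ℝ) : Filter (Model σ ρ) :=
  comap (fun M => (M.na : ℝ) / (M.d : ℝ)) atTop

end Model

end LinearRecourse

end

set_option linter.unusedSectionVars false

/-! Test data are independent of training data, so each conditional risk is the mean squared error
of a fixed linear predictor on fresh units. For the single-stage fit it equals `σ²` plus the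
quadratic form of `S` at the coefficient error `lsq X ε`. For the two-stage fit, with `γ` the
coefficient of the residual column, it is `(1 - ρ²)σ² + (ρ - γ)²σ²` plus a covariate term controlled
by the quadratic forms of `S` and `S0` at the Stage II error and at `γ` times the Stage I error.
Both excesses are shown to be `O_p(d / n_a)`, which is stronger than the stated rate for the
two-stage risk; the limits differ by `ρ²σ²`, whence the strict comparison.

A quadratic form in white noise has mean `σ²` times a trace, so Markov's inequality
(`measure_quad_gt_le`) reduces the coefficient errors to `tr((XᵀX)⁻¹S) = O_p(d / n)`. The rows need
not be centred, so no Wishart formula is used. Instead, the ridge leverages of `n + 1` exchangeable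
rows sum to at most `d`, hence each has mean at most `d / (n + 1)`. The leverage of one row is `u /
(1 + u)`, where `u` is its quadratic form in the inverse ridge Gram matrix of the other `n` rows.
Given those rows, `u` has mean `T`, the ridge trace, and Gaussian kurtosis gives `E u² ≤ 3T²`, so
the leverage has conditional mean at least `T / (4(1 + T))`. Thus `T` is small with high
probability, uniformly in the penalty, which is then sent to zero (`measure_not_gram_good_le`).

For `γ`, Frisch–Waugh (`ols_appendCol`) gives `γ ‖w‖² = w · ε`, where `w` is `ε₀` after both
complementary projections. Each projection removes `O_p(d)` from a squared norm of order `n`, so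
`‖w‖²` is of order `n` and `(γ - ρ)² = O_p(d / n)`. The event `Sample.Good` collects these estimates
and makes the rest deterministic. -/

namespace LinearRecourse

/-! ### Least squares algebra: projections, traces and the Frisch–Waugh decomposition. -/

section LinearAlgebra

variable {m k : Type*} [Fintype m] [Fintype k] [DecidableEq k]

/-- The least squares operator `(Aᵀ A)⁻¹ Aᵀ`. -/
noncomputable def lsq (A : Matrix m k ℝ) : Matrix k m ℝ := (Aᵀ * A)⁻¹ * Aᵀ

/-- The hat matrix `A (Aᵀ A)⁻¹ Aᵀ`. -/
noncomputable def hat (A : Matrix m k ℝ) : Matrix m m ℝ := A * lsq A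

lemma ols_eq_lsq_mulVec (A : Matrix m k ℝ) (y : m → ℝ) : ols A y = lsq A *ᵥ y := by
  simp [ols, lsq, Matrix.mulVec_mulVec]

lemma posSemidef_gram (A : Matrix m k ℝ) : (Aᵀ * A).PosSemidef := by
  simpa using Matrix.posSemidef_conjTranspose_mul_self A

lemma gram_inv_transpose (A : Matrix m k ℝ) : ((Aᵀ * A)⁻¹)ᵀ = (Aᵀ * A)⁻¹ := by
  rw [Matrix.transpose_nonsing_inv, Matrix.transpose_mul, Matrix.transpose_transpose]

/-- The matrix inverse is `0` on singular matrices, so both sides vanish when the Gram matrix is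
singular. The same convention makes `hat A` an orthogonal projection for every `A`, so later trace
bounds need no rank condition. -/
lemma lsq_mul_lsq_transpose (A : Matrix m k ℝ) : lsq A * (lsq A)ᵀ = (Aᵀ * A)⁻¹ := by
  rw [lsq, Matrix.transpose_mul, gram_inv_transpose, Matrix.transpose_transpose]
  by_cases h : IsUnit (Aᵀ * A).det
  · rw [Matrix.mul_assoc, ← Matrix.mul_assoc Aᵀ, Matrix.mul_nonsing_inv _ h, Matrix.mul_one]
  · simp [Matrix.nonsing_inv_apply_not_isUnit _ h]

lemma lsq_mul_self {A : Matrix m k ℝ} (h : IsUnit (Aᵀ * A).det) : lsq A * A = 1 := by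
  rw [lsq, Matrix.mul_assoc, Matrix.nonsing_inv_mul _ h]

lemma hat_transpose (A : Matrix m k ℝ) : (hat A)ᵀ = hat A := by
  simp only [hat, lsq, Matrix.transpose_mul, gram_inv_transpose, Matrix.transpose_transpose,
    Matrix.mul_assoc]

lemma hat_mul_hat (A : Matrix m k ℝ) : hat A * hat A = hat A := by
  by_cases h : IsUnit (Aᵀ * A).det
  · rw [hat, Matrix.mul_assoc, ← Matrix.mul_assoc (lsq A), lsq_mul_self h, Matrix.one_mul]
  · simp [hat, lsq, Matrix.nonsing_inv_apply_not_isUnit _ h]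

lemma hat_mul_self {A : Matrix m k ℝ} (h : IsUnit (Aᵀ * A).det) : hat A * A = A := by
  rw [hat, Matrix.mul_assoc, lsq_mul_self h, Matrix.mul_one]

lemma posSemidef_hat (A : Matrix m k ℝ) : (hat A).PosSemidef := by
  have := Matrix.posSemidef_conjTranspose_mul_self (hat A)
  rwa [Matrix.conjTranspose_eq_transpose_of_trivial, hat_transpose, hat_mul_hat] at this

lemma trace_hat_le (A : Matrix m k ℝ) : (hat A).trace ≤ Fintype.card k := by
  rw [hat, Matrix.trace_mul_comm]
  by_cases h : IsUnit (Aᵀ * A).det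
  · rw [lsq_mul_self h, Matrix.trace_one]
  · simp [lsq, Matrix.nonsing_inv_apply_not_isUnit _ h]

lemma dotProduct_hat_mulVec (A : Matrix m k ℝ) (v : m → ℝ) :
    v ⬝ᵥ (hat A *ᵥ v) = (hat A *ᵥ v) ⬝ᵥ (hat A *ᵥ v) := by
  nth_rw 1 [← hat_mul_hat A]
  rw [← Matrix.mulVec_mulVec, Matrix.dotProduct_mulVec, ← Matrix.mulVec_transpose, hat_transpose]

lemma posSemidef_lsq_conj {S : Matrix k k ℝ} (hS : S.PosSemidef) (A : Matrix m k ℝ) :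
    ((lsq A)ᵀ * S * lsq A).PosSemidef := by
  simpa using hS.conjTranspose_mul_mul_same (lsq A)

lemma trace_lsq_conj (S : Matrix k k ℝ) (A : Matrix m k ℝ) :
    ((lsq A)ᵀ * S * lsq A).trace = ((Aᵀ * A)⁻¹ * S).trace := by
  rw [Matrix.trace_mul_comm, ← Matrix.mul_assoc, lsq_mul_lsq_transpose]

lemma dotProduct_conj_mulVec {l : Type*} [Fintype l] (B : Matrix k l ℝ) (S : Matrix k k ℝ)
    (v : l → ℝ) :
    v ⬝ᵥ ((Bᵀ * S * B) *ᵥ v) = (B *ᵥ v) ⬝ᵥ (S *ᵥ (B *ᵥ v)) := by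
  rw [← Matrix.mulVec_mulVec, ← Matrix.mulVec_mulVec, Matrix.dotProduct_mulVec,
    ← Matrix.mulVec_transpose, Matrix.transpose_transpose]

/-- Compressing a positive semidefinite matrix by the complement of an orthogonal projection
does not increase the trace. -/
lemma trace_compl_conj_le [DecidableEq m] {A H : Matrix m m ℝ} (hA : A.PosSemidef)
    (hH : Hᵀ = H) (hH2 : H * H = H) : ((1 - H) * A * (1 - H)).trace ≤ A.trace := by
  have h1 : ((1 - H) * A * (1 - H)).trace = A.trace - (H * A * H).trace := by
    rw [Matrix.trace_mul_comm, ← Matrix.mul_assoc, Matrix.trace_mul_comm (H * A),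
      ← Matrix.mul_assoc, hH2]
    have : (1 - H) * (1 - H) = 1 - H := by
      simp [Matrix.sub_mul, Matrix.mul_sub, hH2]
    rw [this, Matrix.sub_mul, Matrix.trace_sub, Matrix.one_mul]
  have h2 : 0 ≤ (H * A * H).trace := by
    have := hA.conjTranspose_mul_mul_same H
    rw [Matrix.conjTranspose_eq_transpose_of_trivial, hH] at this
    exact this.trace_nonneg
  linarith

lemma posSemidef_compl_conj [DecidableEq m] {A H : Matrix m m ℝ} (hA : A.PosSemidef)
    (hH : Hᵀ = H) : ((1 - H) * A * (1 - H)).PosSemidef := by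
  have := hA.conjTranspose_mul_mul_same (1 - H)
  rwa [Matrix.conjTranspose_eq_transpose_of_trivial, Matrix.transpose_sub, hH,
    Matrix.transpose_one] at this

lemma posSemidef_add_quad {S : Matrix k k ℝ} (hS : S.PosSemidef) (u v : k → ℝ) :
    (u + v) ⬝ᵥ (S *ᵥ (u + v)) ≤ 2 * (u ⬝ᵥ (S *ᵥ u)) + 2 * (v ⬝ᵥ (S *ᵥ v)) := by
  have h := hS.dotProduct_mulVec_nonneg (u - v)
  simp only [star_trivial, Matrix.mulVec_sub, Matrix.mulVec_add, add_dotProduct, sub_dotProduct,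
    dotProduct_add, dotProduct_sub] at h ⊢
  linarith

lemma smul_quad (S : Matrix k k ℝ) (c : ℝ) (v : k → ℝ) :
    (c • v) ⬝ᵥ (S *ᵥ (c • v)) = c ^ 2 * (v ⬝ᵥ (S *ᵥ v)) := by
  simp only [Matrix.mulVec_smul, smul_dotProduct, dotProduct_smul, smul_eq_mul]; ring

lemma dotProduct_sq_le (u v : m → ℝ) : (u ⬝ᵥ v) ^ 2 ≤ (u ⬝ᵥ u) * (v ⬝ᵥ v) := by
  simp only [dotProduct, ← pow_two]
  exact Finset.sum_mul_sq_le_sq_mul_sq _ _ _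

lemma dotProduct_self_nonneg (u : m → ℝ) : 0 ≤ u ⬝ᵥ u :=
  Finset.sum_nonneg fun _ _ => mul_self_nonneg _

lemma dotProduct_self_add_le (u v w : m → ℝ) :
    (u + v + w) ⬝ᵥ (u + v + w) ≤ 3 * (u ⬝ᵥ u) + 3 * (v ⬝ᵥ v) + 3 * (w ⬝ᵥ w) := by
  simp only [dotProduct, Finset.mul_sum, ← Finset.sum_add_distrib, Pi.add_apply]
  refine Finset.sum_le_sum fun i _ => ?_
  nlinarith [sq_nonneg (u i - v i), sq_nonneg (v i - w i), sq_nonneg (u i - w i)]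

/-- The least squares residual is orthogonal to the design. -/
lemma ols_normal_equation {A : Matrix m k ℝ} (h : IsUnit (Aᵀ * A).det) (y : m → ℝ) :
    Aᵀ *ᵥ (y - A *ᵥ ols A y) = 0 := by
  rw [Matrix.mulVec_sub, ols, Matrix.mulVec_mulVec, Matrix.mulVec_mulVec,
    Matrix.mul_nonsing_inv _ h, Matrix.one_mulVec, sub_self]

lemma isUnit_det_gram_of_injective {A : Matrix m k ℝ} (h : ∀ v, A *ᵥ v = 0 → v = 0) :
    IsUnit (Aᵀ * A).det := by
  have := Matrix.PosDef.conjTranspose_mul_self A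
    (injective_iff_map_eq_zero A.mulVecLin |>.2 (by simpa using h))
  rw [Matrix.conjTranspose_eq_transpose_of_trivial] at this
  exact (Matrix.isUnit_iff_isUnit_det _).1 this.isUnit

lemma appendCol_mulVec (A : Matrix m k ℝ) (r : m → ℝ) (c : k ⊕ Unit → ℝ) :
    appendCol A r *ᵥ c = A *ᵥ (c ∘ Sum.inl) + c (Sum.inr ()) • r := by
  rw [appendCol, Matrix.fromCols_mulVec]
  congr 1
  ext i
  simp [Matrix.mulVec, dotProduct, mul_comm]

/-- Frisch–Waugh: the regression on `(A  r)` with response `A β + e`. -/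
lemma ols_appendCol [DecidableEq m] {A : Matrix m k ℝ} (h : IsUnit (Aᵀ * A).det) (r e w : m → ℝ)
    (β : k → ℝ)
    (hw : w = (1 - hat A) *ᵥ r) (hq : 0 < w ⬝ᵥ w) :
    let c := ols (appendCol A r) (A *ᵥ β + e)
    c ∘ Sum.inl = β + lsq A *ᵥ (e - c (Sum.inr ()) • r) ∧
      c (Sum.inr ()) * (w ⬝ᵥ w) = w ⬝ᵥ e := by
  intro c
  have hMM : (1 - hat A) * (1 - hat A) = 1 - hat A := by
    simp [Matrix.sub_mul, Matrix.mul_sub, hat_mul_hat]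
  have hMt : (1 - hat A)ᵀ = 1 - hat A := by
    rw [Matrix.transpose_sub, hat_transpose, Matrix.transpose_one]
  have hMA : (1 - hat A) * A = 0 := by
    rw [Matrix.sub_mul, hat_mul_self h, Matrix.one_mul, sub_self]
  have hwM (v : m → ℝ) : r ⬝ᵥ ((1 - hat A) *ᵥ v) = w ⬝ᵥ v := by
    rw [Matrix.dotProduct_mulVec, ← Matrix.mulVec_transpose, hMt, hw]
  have hrw : w ⬝ᵥ r = w ⬝ᵥ w := by
    rw [← hwM r]; nth_rw 1 [← hMM]
    rw [← Matrix.mulVec_mulVec, ← hw, hwM]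
  -- Pairing a kernel relation with `(1 - hat A) r` kills the columns of `A` and multiplies the last
  -- coefficient by `w ⬝ᵥ w > 0`; the other coefficients then vanish because `lsq A` is a left
  -- inverse of `A`.
  have hu : IsUnit ((appendCol A r)ᵀ * appendCol A r).det := by
    refine isUnit_det_gram_of_injective fun v hv => ?_
    rw [appendCol_mulVec] at hv
    have h1 : v (Sum.inr ()) = 0 := by
      have := congrArg (fun z => r ⬝ᵥ ((1 - hat A) *ᵥ z)) hv
      simp only [Matrix.mulVec_add, Matrix.mulVec_mulVec, hMA, Matrix.mulVec_smul, ← hw,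
        Matrix.zero_mulVec, zero_add, Matrix.mulVec_zero, dotProduct_zero, dotProduct_smul,
        smul_eq_mul] at this
      rw [dotProduct_comm, hrw] at this
      exact (mul_eq_zero.1 this).resolve_right hq.ne'
    rw [h1, zero_smul, add_zero] at hv
    have h2 := congrArg (fun z => lsq A *ᵥ z) hv
    simp only [Matrix.mulVec_mulVec, lsq_mul_self h, Matrix.one_mulVec, Matrix.mulVec_zero] at h2
    ext (i | i)
    · exact congrFun h2 i
    · simpa using h1
  have hn := ols_normal_equation hu (A *ᵥ β + e)
  set z := A *ᵥ β + e - appendCol A r *ᵥ ols (appendCol A r) (A *ᵥ β + e) with hz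
  have hzeq : z = A *ᵥ (β - c ∘ Sum.inl) + (e - c (Sum.inr ()) • r) := by
    rw [hz, appendCol_mulVec, Matrix.mulVec_sub]
    simp only [c]
    abel
  rw [appendCol, Matrix.transpose_fromCols, Matrix.fromRows_mulVec] at hn
  have hn1 : Aᵀ *ᵥ z = 0 := by ext i; simpa using congrFun hn (Sum.inl i)
  have hn2 : r ⬝ᵥ z = 0 := by
    have := congrFun hn (Sum.inr ())
    simpa [Matrix.mulVec, dotProduct] using this
  have hl : lsq A *ᵥ z = 0 := by
    rw [lsq, ← Matrix.mulVec_mulVec, hn1, Matrix.mulVec_zero]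
  refine ⟨?_, ?_⟩
  · rw [hzeq, Matrix.mulVec_add, Matrix.mulVec_mulVec, lsq_mul_self h, Matrix.one_mulVec] at hl
    rw [← sub_eq_zero, ← neg_eq_zero, ← hl]; abel
  -- The residual `z` is orthogonal to the columns of `A`, so orthogonality to `r` amounts to
  -- orthogonality to `w`.
  · have h3 : (1 - hat A) *ᵥ z = z := by
      rw [Matrix.sub_mulVec, hat, ← Matrix.mulVec_mulVec, hl]; simp
    rw [← h3, hwM, hzeq, dotProduct_add, Matrix.dotProduct_mulVec, ← Matrix.mulVec_transpose,
      hw, ← hMt, Matrix.mulVec_mulVec, ← Matrix.transpose_mul, hMA] at hn2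
    simp only [Matrix.transpose_zero, Matrix.zero_mulVec, zero_dotProduct, hMt, ← hw, dotProduct_sub, dotProduct_smul, smul_eq_mul, hrw] at hn2
    linarith

lemma ols_sub {A : Matrix m k ℝ} (h : IsUnit (Aᵀ * A).det) (β : k → ℝ) (e : m → ℝ) :
    ols A (A *ᵥ β + e) = β + lsq A *ᵥ e := by
  rw [ols_eq_lsq_mulVec, Matrix.mulVec_add, Matrix.mulVec_mulVec, lsq_mul_self h,
    Matrix.one_mulVec]

end LinearAlgebra

/-! ### Measurability of matrix expressions. -/

section Measurability

variable {α : Type*} [MeasurableSpace α] {l m n : Type*}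

lemma measurable_mul_entries [Fintype m] {A : α → Matrix l m ℝ} {B : α → Matrix m n ℝ}
    (hA : ∀ i j, Measurable fun a => A a i j) (hB : ∀ i j, Measurable fun a => B a i j) (i : l)
    (j : n) : Measurable fun a => (A a * B a) i j := by
  simp only [Matrix.mul_apply]
  exact Finset.measurable_sum _ fun k _ => (hA i k).mul (hB k j)

lemma measurable_det [Fintype m] [DecidableEq m] {A : α → Matrix m m ℝ}
    (hA : ∀ i j, Measurable fun a => A a i j) : Measurable fun a => (A a).det := by
  simp only [Matrix.det_apply]
  exact Finset.measurable_sum _ fun σ _ =>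
    (Finset.measurable_prod _ fun i _ => hA _ _).const_smul _

lemma measurable_inv_entries [Fintype m] [DecidableEq m] {A : α → Matrix m m ℝ}
    (hA : ∀ i j, Measurable fun a => A a i j) (i j : m) :
    Measurable fun a => (A a)⁻¹ i j := by
  simp only [Matrix.inv_def, Ring.inverse_eq_inv', Matrix.smul_apply, Matrix.adjugate_apply,
    smul_eq_mul]
  refine (measurable_det hA).inv.mul (measurable_det fun k l => ?_)
  by_cases h : k = j
  · subst h; simp
  · simpa [Matrix.updateRow_ne h] using hA k l

lemma measurable_trace [Fintype m] {A : α → Matrix m m ℝ}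
    (hA : ∀ i j, Measurable fun a => A a i j) : Measurable fun a => (A a).trace := by
  simp only [Matrix.trace, Matrix.diag]
  exact Finset.measurable_sum _ fun k _ => hA k k

lemma measurable_lsq_entries [Fintype m] [Fintype l] [DecidableEq m] {A : α → Matrix l m ℝ}
    (hA : ∀ i j, Measurable fun a => A a i j) (i : m) (j : l) :
    Measurable fun a => lsq (A a) i j :=
  measurable_mul_entries
    (measurable_inv_entries (measurable_mul_entries (fun i j => hA j i) hA)) (fun i j => hA j i) i j

lemma measurable_hat_entries [Fintype m] [Fintype l] [DecidableEq m] {A : α → Matrix l m ℝ}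
    (hA : ∀ i j, Measurable fun a => A a i j) (i j : l) :
    Measurable fun a => hat (A a) i j :=
  measurable_mul_entries hA (measurable_lsq_entries hA) i j

lemma measurable_dotProduct [Fintype m] {u v : α → m → ℝ} (hu : ∀ i, Measurable fun a => u a i)
    (hv : ∀ i, Measurable fun a => v a i) : Measurable fun a => u a ⬝ᵥ v a := by
  simp only [dotProduct]
  exact Finset.measurable_sum _ fun i _ => (hu i).mul (hv i)

lemma measurable_mulVec_entries [Fintype m] {A : α → Matrix l m ℝ} {v : α → m → ℝ}
    (hA : ∀ i j, Measurable fun a => A a i j) (hv : ∀ i, Measurable fun a => v a i) (i : l) :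
    Measurable fun a => (A a *ᵥ v a) i :=
  measurable_dotProduct (hA i) hv

end Measurability

/-! ### Second and fourth moments of real Gaussians. -/

section GaussianMoments

/-- Differentiation keeps the form polynomial times Gaussian mgf, with `p` replaced by `p' + p (m +
v t)`. Four iterations from `p = 1` give the fourth moment. -/
lemma hasDerivAt_mul_gaussian_mgf (m v : ℝ) {p : ℝ → ℝ} {p' t : ℝ} (hp : HasDerivAt p p' t) :
    HasDerivAt (fun t => p t * Real.exp (m * t + v * t ^ 2 / 2))
      ((p' + p t * (m + v * t)) * Real.exp (m * t + v * t ^ 2 / 2)) t := by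
  have h1 : HasDerivAt (fun t : ℝ => m * t + v * t ^ 2 / 2) (m + v * t) t := by
    refine (((hasDerivAt_id' t).const_mul m).fun_add
      ((((hasDerivAt_id' t).fun_pow 2).const_mul v).div_const 2)).congr_deriv ?_
    push_cast; ring
  exact (hp.fun_mul h1.exp).congr_deriv (by ring)

lemma integral_pow_four_gaussianReal (m : ℝ) (v : NNReal) :
    ∫ x, x ^ 4 ∂(gaussianReal m v) = m ^ 4 + 6 * m ^ 2 * v + 3 * (v : ℝ) ^ 2 := by
  have h := iteratedDeriv_mgf_zero (X := id) (μ := gaussianReal m v) (by simp) 4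
  rw [mgf_id_gaussianReal] at h
  have hlin (t : ℝ) : HasDerivAt (fun t : ℝ => m + v * t) v t := by
    simpa using ((hasDerivAt_id t).const_mul (v : ℝ)).const_add m
  have e0 : (fun t : ℝ => Real.exp (m * t + v * t ^ 2 / 2))
      = fun t => (1 : ℝ) * Real.exp (m * t + v * t ^ 2 / 2) := by simp
  have d1 : deriv (fun t : ℝ => Real.exp (m * t + v * t ^ 2 / 2))
      = fun t => (m + v * t) * Real.exp (m * t + v * t ^ 2 / 2) := by
    rw [e0]; funext t
    rw [(hasDerivAt_mul_gaussian_mgf m v (hasDerivAt_const t (1 : ℝ))).deriv]; ring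
  have d2 : deriv (fun t : ℝ => (m + v * t) * Real.exp (m * t + v * t ^ 2 / 2))
      = fun t => ((m + v * t) ^ 2 + v) * Real.exp (m * t + v * t ^ 2 / 2) := by
    funext t
    rw [(hasDerivAt_mul_gaussian_mgf m v (hlin t)).deriv]; ring
  have d3 : deriv (fun t : ℝ => ((m + v * t) ^ 2 + v) * Real.exp (m * t + v * t ^ 2 / 2))
      = fun t => ((m + v * t) ^ 3 + 3 * v * (m + v * t)) *
        Real.exp (m * t + v * t ^ 2 / 2) := by
    funext t
    rw [(hasDerivAt_mul_gaussian_mgf m v (((hlin t).fun_pow 2).add_const (v : ℝ))).deriv]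
    push_cast; ring
  have d4 : deriv (fun t : ℝ => ((m + v * t) ^ 3 + 3 * v * (m + v * t)) *
        Real.exp (m * t + v * t ^ 2 / 2)) 0 = m ^ 4 + 6 * m ^ 2 * v + 3 * (v : ℝ) ^ 2 := by
    rw [(hasDerivAt_mul_gaussian_mgf m v
      (((hlin 0).fun_pow 3).fun_add ((hlin 0).const_mul (3 * (v : ℝ))))).deriv]
    simp; ring
  rw [iteratedDeriv_succ, iteratedDeriv_succ, iteratedDeriv_succ, iteratedDeriv_one, d1, d2, d3,
    d4] at h
  simpa using h.symm

lemma integral_sq_gaussianReal (m : ℝ) (v : NNReal) :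
    ∫ x, x ^ 2 ∂(gaussianReal m v) = m ^ 2 + v := by
  have h := variance_eq_sub (memLp_id_gaussianReal' (μ := m) (v := v) 2 (by simp))
  rw [variance_id_gaussianReal] at h
  simp only [Pi.pow_apply, id_eq, integral_id_gaussianReal] at h
  linarith

variable {Ω : Type*} [MeasurableSpace Ω] {P : Measure Ω}

/-- The kurtosis of a possibly noncentred real Gaussian is at most three. -/
lemma integral_pow_four_le {y : Ω → ℝ} (hy : HasGaussianLaw y P) :
    ∫ ω, y ω ^ 4 ∂P ≤ 3 * (∫ ω, y ω ^ 2 ∂P) ^ 2 := by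
  have hl := hy.map_eq_gaussianReal
  have h4 : ∫ ω, y ω ^ 4 ∂P = ∫ x, x ^ 4 ∂(P.map y) :=
    (integral_map (f := fun x : ℝ => x ^ 4) hy.aemeasurable (by fun_prop)).symm
  have h2 : ∫ ω, y ω ^ 2 ∂P = ∫ x, x ^ 2 ∂(P.map y) :=
    (integral_map (f := fun x : ℝ => x ^ 2) hy.aemeasurable (by fun_prop)).symm
  rw [h4, h2, hl, integral_pow_four_gaussianReal, integral_sq_gaussianReal]
  -- With mean `m` and variance `v`, the gap is `3(m² + v)² - (m⁴ + 6m²v + 3v²) = 2m⁴`.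
  nlinarith [sq_nonneg (∫ ω, y ω ∂P), sq_nonneg ((∫ ω, y ω ∂P) ^ 2)]

lemma integrable_pow_of_gaussian {y : Ω → ℝ} (hy : HasGaussianLaw y P) (n : ℕ) :
    Integrable (fun ω => y ω ^ n) P := by
  have := hy.isProbabilityMeasure
  have h := (hy.memLp (p := n) (by simp)).integrable_norm_pow'
  refine h.mono (hy.aemeasurable.pow_const n).aestronglyMeasurable ?_
  simp

end GaussianMoments

/-! ### Quadratic forms in a Gaussian vector. -/

section QuadraticForms

variable {d : ℕ} {μ : Measure (Fin d → ℝ)} [IsGaussian μ]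

lemma hasGaussianLaw_dotProduct (v : Fin d → ℝ) :
    HasGaussianLaw (fun x : Fin d → ℝ => v ⬝ᵥ x) μ := by
  have := (IsGaussian.hasGaussianLaw_id (μ := μ)).map_fun
    (LinearMap.toContinuousLinearMap (dotProductBilin ℝ ℝ v))
  simpa using this

lemma integrable_mul_coord (k l : Fin d) : Integrable (fun x : Fin d → ℝ => x k * x l) μ := by
  have h (k : Fin d) : MemLp (fun x : Fin d → ℝ => x k) 2 μ := by
    have := (hasGaussianLaw_dotProduct (μ := μ) (Pi.single k 1)).memLp_two
    simpa using this
  exact (h k).integrable_mul (h l)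

lemma quad_eq_sum {m : Type*} [Fintype m] (A : Matrix m m ℝ) (x : m → ℝ) :
    x ⬝ᵥ (A *ᵥ x) = ∑ k, ∑ l, A k l * (x l * x k) := by
  simp only [dotProduct, Matrix.mulVec, Finset.mul_sum]
  exact Finset.sum_congr rfl fun k _ => Finset.sum_congr rfl fun l _ => by ring

lemma integrable_quad (A : Matrix (Fin d) (Fin d) ℝ) :
    Integrable (fun x : Fin d → ℝ => x ⬝ᵥ (A *ᵥ x)) μ := by
  simp only [quad_eq_sum]
  exact integrable_finsetSum _ fun k _ => integrable_finsetSum _ fun l _ =>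
    (integrable_mul_coord l k).const_mul _

lemma integral_quad {S : Matrix (Fin d) (Fin d) ℝ} (hS : ∀ k l, ∫ x, x k * x l ∂μ = S k l)
    (A : Matrix (Fin d) (Fin d) ℝ) :
    ∫ x, x ⬝ᵥ (A *ᵥ x) ∂μ = (A * S).trace := by
  simp only [quad_eq_sum]
  refine (integral_finsetSum _ fun k _ => integrable_finsetSum _ fun l _ =>
    (integrable_mul_coord l k).const_mul _).trans ?_
  simp only [Matrix.trace, Matrix.diag, Matrix.mul_apply]
  refine Finset.sum_congr rfl fun k _ => ?_
  rw [integral_finsetSum _ fun l _ => (integrable_mul_coord l k).const_mul _]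
  simp only [integral_const_mul, hS]

lemma quad_sum_vecMulVec {N : ℕ} (v : Fin N → Fin d → ℝ) (x : Fin d → ℝ) :
    x ⬝ᵥ ((∑ i, Matrix.vecMulVec (v i) (star (v i))) *ᵥ x) = ∑ i, (v i ⬝ᵥ x) ^ 2 := by
  rw [Matrix.sum_mulVec, dotProduct_sum]
  refine Finset.sum_congr rfl fun i _ => ?_
  rw [Matrix.vecMulVec_mulVec, star_trivial]
  simp [dotProduct_comm, pow_two]

lemma integrable_quad_sq {A : Matrix (Fin d) (Fin d) ℝ} (hA : A.PosSemidef) :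
    Integrable (fun x : Fin d → ℝ => (x ⬝ᵥ (A *ᵥ x)) ^ 2) μ := by
  obtain ⟨N, v, rfl⟩ := Matrix.posSemidef_iff_eq_sum_vecMulVec.1 hA
  simp only [quad_sum_vecMulVec, pow_two (∑ i, _), Finset.sum_mul_sum]
  refine integrable_finsetSum _ fun i _ => integrable_finsetSum _ fun j _ => ?_
  have h (i) : MemLp (fun x : Fin d → ℝ => (v i ⬝ᵥ x) ^ 2) 2 μ := by
    refine (memLp_two_iff_integrable_sq ?_).2 ?_
    · exact (integrable_pow_of_gaussian (hasGaussianLaw_dotProduct (v i)) 2).1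
    · simp only [← pow_mul]
      exact integrable_pow_of_gaussian (hasGaussianLaw_dotProduct (v i)) 4
  exact (h i).integrable_mul (h j)

/-- Writing `A` as a sum of rank-one matrices turns the form into `∑ yᵢ²` with scalar Gaussian `yᵢ`.
Cauchy–Schwarz with weights `sᵢ = E yᵢ²` gives `(∑ yᵢ²)² ≤ (∑ sᵢ) ∑ yᵢ⁴ / sᵢ`, and the scalar
kurtosis bound applies to each term. No independence of the `yᵢ` is needed. -/
lemma integral_quad_sq_le {A : Matrix (Fin d) (Fin d) ℝ} (hA : A.PosSemidef) :
    ∫ x, (x ⬝ᵥ (A *ᵥ x)) ^ 2 ∂μ ≤ 3 * (∫ x, x ⬝ᵥ (A *ᵥ x) ∂μ) ^ 2 := by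
  have hint := integrable_quad_sq (μ := μ) hA
  obtain ⟨N, v, rfl⟩ := Matrix.posSemidef_iff_eq_sum_vecMulVec.1 hA
  simp only [quad_sum_vecMulVec] at hint ⊢
  have hi (i) (n : ℕ) : Integrable (fun x : Fin d → ℝ => (v i ⬝ᵥ x) ^ n) μ :=
    integrable_pow_of_gaussian (hasGaussianLaw_dotProduct (v i)) n
  set s : Fin N → ℝ := fun i => ∫ x, (v i ⬝ᵥ x) ^ 2 ∂μ with hs
  have hs0 (i) : 0 ≤ s i := integral_nonneg fun x => sq_nonneg _
  have hT : ∫ x, ∑ i, (v i ⬝ᵥ x) ^ 2 ∂μ = ∑ i, s i := integral_finsetSum _ fun i _ => hi i 2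
  -- Division by `sᵢ = 0` yields `0`, so the weighted inequality needs `yᵢ = 0` almost surely for
  -- those indices.
  have hae : ∀ᵐ x ∂μ, ∀ i, s i = 0 → v i ⬝ᵥ x = 0 := by
    rw [ae_all_iff]
    intro i
    by_cases h : s i = 0
    · have := (integral_eq_zero_iff_of_nonneg (fun x => sq_nonneg _) (hi i 2)).1 h
      filter_upwards [this] with x hx _
      simpa using hx
    · exact Eventually.of_forall fun x hx => absurd hx h
  have hbound : ∀ᵐ x ∂μ, (∑ i, (v i ⬝ᵥ x) ^ 2) ^ 2
      ≤ (∑ i, s i) * ∑ i, (v i ⬝ᵥ x) ^ 4 / s i := by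
    filter_upwards [hae] with x hx
    refine Finset.sum_sq_le_sum_mul_sum_of_sq_le_mul _ (fun i _ => hs0 i)
      (fun i _ => div_nonneg (by positivity) (hs0 i)) fun i _ => ?_
    by_cases h : s i = 0
    · simp [hx i h]
    · rw [mul_div_cancel₀ _ h, ← pow_mul]
  have hi2 : Integrable (fun x : Fin d → ℝ => (∑ i, s i) * ∑ i, (v i ⬝ᵥ x) ^ 4 / s i) μ :=
    (integrable_finsetSum _ fun i _ => (hi i 4).div_const _).const_mul _
  refine (integral_mono_ae hint hi2 hbound).trans ?_
  rw [hT, integral_const_mul, integral_finsetSum _ fun i _ => (hi i 4).div_const _]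
  have : ∑ i, ∫ x, (v i ⬝ᵥ x) ^ 4 / s i ∂μ ≤ ∑ i, 3 * s i := by
    refine Finset.sum_le_sum fun i _ => ?_
    rw [integral_div]
    refine div_le_of_le_mul₀ (hs0 i) (by linarith [hs0 i]) ?_
    have := integral_pow_four_le (hasGaussianLaw_dotProduct (μ := μ) (v i))
    nlinarith
  rw [← Finset.mul_sum] at this
  nlinarith [Finset.sum_nonneg fun i (_ : i ∈ Finset.univ) => hs0 i]

/-- Jensen's inequality goes the wrong way for the concave `u / (1 + u)`; a parabola below it allows
a bound through two moments. The coefficient `1 / (4T)` is chosen so that `E u² ≤ 3T²` still leaves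
`T - 3T/4 = T/4`. -/
lemma div_one_add_lower {u T : ℝ} (hu : 0 ≤ u) (hT : 0 < T) :
    (1 / (1 + T)) * (u - (1 / (4 * T)) * u ^ 2) ≤ u / (1 + u) := by
  rw [div_mul_eq_mul_div, div_le_div_iff₀ (by linarith) (by linarith)]
  have : u * (1 + T) - 1 * (u - 1 / (4 * T) * u ^ 2) * (1 + u)
      = u * (u / 2 - T) ^ 2 / T + u ^ 2 / (4 * T) := by field_simp; ring
  have : 0 ≤ u * (u / 2 - T) ^ 2 / T + u ^ 2 / (4 * T) := by positivity
  linarith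

lemma integral_div_one_add_quad_ge {A : Matrix (Fin d) (Fin d) ℝ} (hA : A.PosSemidef) {T : ℝ}
    (hT : ∫ x, x ⬝ᵥ (A *ᵥ x) ∂μ = T) :
    T / (4 * (1 + T)) ≤ ∫ x, (x ⬝ᵥ (A *ᵥ x)) / (1 + x ⬝ᵥ (A *ᵥ x)) ∂μ := by
  have hnn (x : Fin d → ℝ) : 0 ≤ x ⬝ᵥ (A *ᵥ x) := by
    simpa using hA.dotProduct_mulVec_nonneg x
  have hT0 : 0 ≤ T := hT ▸ integral_nonneg hnn
  rcases hT0.eq_or_lt with h0 | h0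
  · rw [← h0, zero_div]
    exact integral_nonneg fun x => div_nonneg (hnn x) (by linarith [hnn x])
  have hq := integrable_quad (μ := μ) A
  have hq2 := integrable_quad_sq (μ := μ) hA
  have hi1 : Integrable (fun x : Fin d → ℝ =>
      (1 / (1 + T)) * (x ⬝ᵥ (A *ᵥ x) - (1 / (4 * T)) * (x ⬝ᵥ (A *ᵥ x)) ^ 2)) μ :=
    (hq.sub (hq2.const_mul _)).const_mul _
  have hi2 : Integrable (fun x : Fin d → ℝ => (x ⬝ᵥ (A *ᵥ x)) / (1 + x ⬝ᵥ (A *ᵥ x))) μ := by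
    refine hq.mono (hq.1.aemeasurable.div (hq.1.aemeasurable.const_add 1)).aestronglyMeasurable
      (Eventually.of_forall fun x => ?_)
    rw [Real.norm_of_nonneg (div_nonneg (hnn x) (by linarith [hnn x])),
      Real.norm_of_nonneg (hnn x)]
    exact div_le_self (hnn x) (by linarith [hnn x])
  refine le_trans ?_ (integral_mono hi1 hi2 fun x => div_one_add_lower (hnn x) h0)
  rw [integral_const_mul, integral_sub hq (hq2.const_mul _), integral_const_mul, hT]
  have := integral_quad_sq_le (μ := μ) hA
  rw [hT] at this
  have h3 : 1 / (4 * T) * ∫ x, (x ⬝ᵥ (A *ᵥ x)) ^ 2 ∂μ ≤ 1 / (4 * T) * (3 * T ^ 2) := by gcongr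
  have h4 : 1 / (4 * T) * (3 * T ^ 2) = 3 / 4 * T := by field_simp
  have h5 : T / (4 * (1 + T)) = 1 / (1 + T) * (T - 3 / 4 * T) := by field_simp; ring
  rw [h5]
  exact mul_le_mul_of_nonneg_left (by linarith) (by positivity)

end QuadraticForms

/-! ### Ridge leverages and exchangeability. -/

section Leverage

variable {d n : ℕ}

/-- The ridge Gram matrix `Xᵀ X + τ I`. -/
noncomputable def ridgeGram (τ : ℝ) (x : Fin n → Fin d → ℝ) : Matrix (Fin d) (Fin d) ℝ :=
  (Matrix.of x)ᵀ * Matrix.of x + τ • 1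

/-- The ridge leverage of unit `i`. -/
noncomputable def leverage (τ : ℝ) (x : Fin n → Fin d → ℝ) (i : Fin n) : ℝ :=
  x i ⬝ᵥ ((ridgeGram τ x)⁻¹ *ᵥ x i)

lemma posDef_ridgeGram {τ : ℝ} (hτ : 0 < τ) (x : Fin n → Fin d → ℝ) : (ridgeGram τ x).PosDef :=
  Matrix.PosDef.posSemidef_add (posSemidef_gram _) (Matrix.PosDef.one.smul hτ)

lemma isUnit_det_ridgeGram {τ : ℝ} (hτ : 0 < τ) (x : Fin n → Fin d → ℝ) :
    IsUnit (ridgeGram τ x).det :=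
  (Matrix.isUnit_iff_isUnit_det _).1 (posDef_ridgeGram hτ x).isUnit

lemma leverage_nonneg {τ : ℝ} (hτ : 0 < τ) (x : Fin n → Fin d → ℝ) (i : Fin n) :
    0 ≤ leverage τ x i := by
  simpa [leverage] using (posDef_ridgeGram hτ x).inv.posSemidef.dotProduct_mulVec_nonneg (x i)

/-- With `G = XᵀX`, the sum is `tr((G + τI)⁻¹G) = d - τ tr((G + τI)⁻¹)`. -/
lemma sum_leverage_le {τ : ℝ} (hτ : 0 < τ) (x : Fin n → Fin d → ℝ) :
    ∑ i, leverage τ x i ≤ d := by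
  have h1 : ∑ i, leverage τ x i
      = ((ridgeGram τ x)⁻¹ * ((Matrix.of x)ᵀ * Matrix.of x)).trace := by
    rw [← Matrix.mul_assoc, Matrix.trace_mul_comm, ← Matrix.mul_assoc]
    simp only [leverage, Matrix.trace, Matrix.diag, Matrix.dotProduct_mulVec]
    rfl
  have h2 : (Matrix.of x)ᵀ * Matrix.of x = ridgeGram τ x - τ • 1 := by simp [ridgeGram]
  rw [h1, h2, Matrix.mul_sub, Matrix.nonsing_inv_mul _ (isUnit_det_ridgeGram hτ x),
    Matrix.trace_sub, Matrix.trace_one, Fintype.card_fin, Matrix.mul_smul, Matrix.mul_one,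
    Matrix.trace_smul, smul_eq_mul]
  have := (posDef_ridgeGram hτ x).inv.posSemidef.trace_nonneg
  nlinarith

lemma leverage_le {τ : ℝ} (hτ : 0 < τ) (x : Fin n → Fin d → ℝ) (i : Fin n) :
    leverage τ x i ≤ d :=
  (Finset.single_le_sum (fun j _ => leverage_nonneg hτ x j) (Finset.mem_univ i)).trans
    (sum_leverage_le hτ x)

lemma ridgeGram_succ (τ : ℝ) (x : Fin (n + 1) → Fin d → ℝ) :
    ridgeGram τ x = Matrix.vecMulVec (x 0) (x 0) + ridgeGram τ (fun j => x j.succ) := by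
  ext k l
  simp only [ridgeGram, Matrix.add_apply, Matrix.mul_apply, Fin.sum_univ_succ,
    Matrix.transpose_apply, Matrix.of_apply, Matrix.vecMulVec_apply]
  ring

/-- The leverage of a unit in terms of the Gram matrix of the other units. -/
lemma leverage_zero {τ : ℝ} (hτ : 0 < τ) (x : Fin (n + 1) → Fin d → ℝ) :
    leverage τ x 0 =
      (x 0 ⬝ᵥ ((ridgeGram τ fun j => x j.succ)⁻¹ *ᵥ x 0)) /
        (1 + x 0 ⬝ᵥ ((ridgeGram τ fun j => x j.succ)⁻¹ *ᵥ x 0)) := by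
  set A := ridgeGram τ fun j => x j.succ with hA
  set w := A⁻¹ *ᵥ x 0 with hw
  have hAu : IsUnit A.det := isUnit_det_ridgeGram hτ _
  have hu : 0 ≤ x 0 ⬝ᵥ w := by
    simpa using (posDef_ridgeGram hτ fun j => x (Fin.succ j)).inv.posSemidef.dotProduct_mulVec_nonneg
      (x 0)
  -- Sherman–Morrison in vector form: restoring row `0` adds a rank-one term that maps `w` to a
  -- multiple of `x 0`.
  have h1 : ridgeGram τ x *ᵥ w = (1 + x 0 ⬝ᵥ w) • x 0 := by
    rw [ridgeGram_succ, ← hA, Matrix.add_mulVec, Matrix.vecMulVec_mulVec, hw, Matrix.mulVec_mulVec,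
      Matrix.mul_nonsing_inv _ hAu, Matrix.one_mulVec, ← hw, add_smul, one_smul, add_comm]
    simp
  have h2 : (1 + x 0 ⬝ᵥ w) • ((ridgeGram τ x)⁻¹ *ᵥ x 0) = w := by
    rw [← Matrix.mulVec_smul, ← h1, Matrix.mulVec_mulVec,
      Matrix.nonsing_inv_mul _ (isUnit_det_ridgeGram hτ x), Matrix.one_mulVec]
  have h3 : (1 + x 0 ⬝ᵥ w) * leverage τ x 0 = x 0 ⬝ᵥ w := by
    rw [leverage, ← smul_eq_mul, ← dotProduct_smul, h2]
  rw [eq_div_iff (by positivity), mul_comm, h3]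

lemma leverage_comp_perm (τ : ℝ) (x : Fin n → Fin d → ℝ) (e : Equiv.Perm (Fin n)) (i : Fin n) :
    leverage τ (fun j => x (e j)) i = leverage τ x (e i) := by
  have : ridgeGram τ (fun j => x (e j)) = ridgeGram τ x := by
    ext k l
    simp only [ridgeGram, Matrix.add_apply, Matrix.mul_apply, Matrix.transpose_apply,
      Matrix.of_apply]
    rw [Equiv.sum_comp e (fun j => x j k * x j l)]
  rw [leverage, this, leverage]

lemma measurable_ridgeGram_inv (τ : ℝ) (k l : Fin d) :
    Measurable fun x : Fin n → Fin d → ℝ => (ridgeGram τ x)⁻¹ k l := by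
  refine measurable_inv_entries (fun k l => ?_) k l
  simp only [ridgeGram, Matrix.add_apply]
  refine (measurable_mul_entries (fun i j => ?_) (fun i j => ?_) k l).add_const _
  all_goals simp only [Matrix.transpose_apply, Matrix.of_apply]; fun_prop

lemma measurable_leverage (τ : ℝ) (i : Fin n) :
    Measurable fun x : Fin n → Fin d → ℝ => leverage τ x i :=
  measurable_dotProduct (fun k => by fun_prop)
    (measurable_mulVec_entries (measurable_ridgeGram_inv τ) fun k => by fun_prop)

variable {μ : Measure (Fin d → ℝ)} [IsProbabilityMeasure μ]

lemma integrable_leverage {τ : ℝ} (hτ : 0 < τ) (i : Fin n) :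
    Integrable (fun x => leverage τ x i) (Measure.pi fun _ : Fin n => μ) :=
  Integrable.of_bound (measurable_leverage τ i).aestronglyMeasurable d
    (Eventually.of_forall fun x => by
      rw [Real.norm_of_nonneg (leverage_nonneg hτ x i)]; exact leverage_le hτ x i)

/-- Permuting i.i.d. rows permutes the leverages without changing the law, so all `n + 1` have the
same mean, and they sum to at most `d`. -/
lemma integral_leverage_zero_le {τ : ℝ} (hτ : 0 < τ) :
    ∫ x, leverage τ x 0 ∂(Measure.pi fun _ : Fin (n + 1) => μ) ≤ d / (n + 1) := by
  have hi (i : Fin (n + 1)) : ∫ x, leverage τ x i ∂(Measure.pi fun _ : Fin (n + 1) => μ)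
      = ∫ x, leverage τ x 0 ∂(Measure.pi fun _ : Fin (n + 1) => μ) := by
    have hp := measurePreserving_arrowCongr' (fun _ : Fin (n + 1) => μ) (fun _ => μ)
      (Equiv.swap 0 i) (MeasurableEquiv.refl _) (fun _ => MeasurePreserving.id μ)
    rw [← hp.integral_comp' (fun x => leverage τ x 0)]
    refine integral_congr_ae (Eventually.of_forall fun x => ?_)
    have := leverage_comp_perm τ x (Equiv.swap 0 i).symm 0
    simp only [Equiv.symm_swap, Equiv.swap_apply_left] at this
    exact this.symm
  have hs : ∑ i, ∫ x, leverage τ x i ∂(Measure.pi fun _ : Fin (n + 1) => μ) ≤ d := by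
    rw [← integral_finsetSum _ fun i _ => integrable_leverage hτ i]
    refine (integral_mono (integrable_finsetSum _ fun i _ => integrable_leverage hτ i)
      (integrable_const (d : ℝ)) fun x => sum_leverage_le hτ x).trans (by simp)
  simp only [hi, Finset.sum_const, Finset.card_univ, Fintype.card_fin, nsmul_eq_mul] at hs
  rw [le_div_iff₀ (by positivity)]
  push_cast at hs
  linarith

variable [IsGaussian μ] {S : Matrix (Fin d) (Fin d) ℝ}

/-- The trace of `(Xᵀ X + τ I)⁻¹ S`, saturated, is of order `d / n` in expectation. -/
lemma integral_ridgeTrace_le (hS : ∀ k l, ∫ x, x k * x l ∂μ = S k l) {τ : ℝ} (hτ : 0 < τ) :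
    ∫ x, ((ridgeGram τ x)⁻¹ * S).trace / (4 * (1 + ((ridgeGram τ x)⁻¹ * S).trace))
      ∂(Measure.pi fun _ : Fin n => μ) ≤ d / (n + 1) := by
  refine le_trans ?_ (integral_leverage_zero_le (μ := μ) (n := n) hτ)
  -- Row `0` is split off and integrated first, with the other `n` rows frozen. Starting from `n +
  -- 1` rows is what leaves an `n`-row Gram matrix.
  have hp := (measurePreserving_piFinSuccAbove (fun _ : Fin (n + 1) => μ) 0).symm
  rw [← hp.integral_comp']
  rw [integral_prod_symm]
  swap
  · exact (hp.integrable_comp_emb (MeasurableEquiv.measurableEmbedding _)).2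
      (integrable_leverage hτ 0)
  refine integral_mono_of_nonneg (Eventually.of_forall fun x => ?_) ?_
    (Eventually.of_forall fun x => ?_)
  · have : 0 ≤ ((ridgeGram τ x)⁻¹ * S).trace := by
      rw [← integral_quad hS]
      exact integral_nonneg fun z => by
        simpa using (posDef_ridgeGram hτ x).inv.posSemidef.dotProduct_mulVec_nonneg z
    exact div_nonneg this (by linarith)
  · exact ((hp.integrable_comp_emb (MeasurableEquiv.measurableEmbedding _)).2
      (integrable_leverage hτ 0)).integral_prod_right
  · refine (integral_div_one_add_quad_ge (μ := μ) (posDef_ridgeGram hτ x).inv.posSemidef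
      (integral_quad hS _)).trans (le_of_eq ?_)
    refine integral_congr_ae (Eventually.of_forall fun z => ?_)
    simp only
    rw [leverage_zero hτ]
    rfl

end Leverage

/-! ### Removing the ridge: the trace of the inverse Gram matrix. -/

section InverseGramTrace

variable {d n : ℕ}

lemma trace_mul_sum_vecMulVec {N : ℕ} (D : Matrix (Fin d) (Fin d) ℝ) (u : Fin N → Fin d → ℝ) :
    (D * ∑ i, Matrix.vecMulVec (u i) (star (u i))).trace = ∑ i, u i ⬝ᵥ (D *ᵥ u i) := by
  rw [Matrix.mul_sum, Matrix.trace_sum]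
  refine Finset.sum_congr rfl fun i _ => ?_
  rw [Matrix.mul_vecMulVec, Matrix.trace_vecMulVec, star_trivial, dotProduct_comm]

/-- Positivity of `D` at the component of `u` orthogonal to `v`; the eigenvector relation decouples
the two components. It is applied to a kernel vector of the Gram matrix, where the ridge inverse has
eigenvalue `1 / τ`. -/
lemma quad_ge_of_eigenvector {D : Matrix (Fin d) (Fin d) ℝ} (hD : D.PosSemidef) {v : Fin d → ℝ}
    {c : ℝ} (hv : D *ᵥ v = c • v) (hv0 : v ≠ 0) (u : Fin d → ℝ) :
    c * (u ⬝ᵥ v) ^ 2 / (v ⬝ᵥ v) ≤ u ⬝ᵥ (D *ᵥ u) := by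
  have hvv : v ⬝ᵥ v ≠ 0 := by simpa using hv0
  have hsymm : v ⬝ᵥ (D *ᵥ u) = c * (u ⬝ᵥ v) := by
    have ht : Dᵀ = D := (Matrix.isHermitian_iff_isSymm.1 hD.isHermitian).eq
    rw [Matrix.dotProduct_mulVec, ← Matrix.mulVec_transpose, ht, hv, smul_dotProduct,
      dotProduct_comm, smul_eq_mul]
  have h := hD.dotProduct_mulVec_nonneg (u - ((u ⬝ᵥ v) / (v ⬝ᵥ v)) • v)
  simp only [star_trivial, Matrix.mulVec_sub, Matrix.mulVec_smul, hv, sub_dotProduct,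
    dotProduct_sub, smul_dotProduct, dotProduct_smul, smul_eq_mul, hsymm] at h
  have e : c * (u ⬝ᵥ v) ^ 2 / (v ⬝ᵥ v) = u ⬝ᵥ (D *ᵥ u) - (u ⬝ᵥ D *ᵥ u - u ⬝ᵥ v / v ⬝ᵥ v * (c * (u ⬝ᵥ v)) -
      (u ⬝ᵥ v / v ⬝ᵥ v * (c * (u ⬝ᵥ v)) - u ⬝ᵥ v / v ⬝ᵥ v * (u ⬝ᵥ v / v ⬝ᵥ v * (c * (v ⬝ᵥ v))))) := by
    field_simp; ring
  rw [e]
  have h' : 0 ≤ (u ⬝ᵥ D *ᵥ u - u ⬝ᵥ v / v ⬝ᵥ v * (c * (u ⬝ᵥ v)) -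
      (u ⬝ᵥ v / v ⬝ᵥ v * (c * (u ⬝ᵥ v)) - u ⬝ᵥ v / v ⬝ᵥ v * (u ⬝ᵥ v / v ⬝ᵥ v * (c * (v ⬝ᵥ v))))) := by
    linarith
  linarith

/-- If the ridge traces stay bounded along a sequence of penalties tending to zero, then the
unpenalized Gram matrix is invertible and satisfies the same bound. -/
lemma isUnit_and_trace_le_of_frequently {S : Matrix (Fin d) (Fin d) ℝ} (hS : S.PosDef)
    (x : Fin n → Fin d → ℝ) {t : ℝ} {τ : ℕ → ℝ} (hτ : ∀ k, 0 < τ k)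
    (hlim : Tendsto τ atTop (𝓝 0))
    (hf : ∃ᶠ k in atTop, ((ridgeGram (τ k) x)⁻¹ * S).trace ≤ t) :
    IsUnit ((Matrix.of x)ᵀ * Matrix.of x).det ∧
      (((Matrix.of x)ᵀ * Matrix.of x)⁻¹ * S).trace ≤ t := by
  set A := (Matrix.of x)ᵀ * Matrix.of x with hA
  have hunit : IsUnit A.det := by
    by_contra hsing
    obtain ⟨v, hv0, hv⟩ := Matrix.exists_mulVec_eq_zero_iff.2 (by simpa using hsing)
    have hvv : 0 < v ⬝ᵥ v :=
      lt_of_le_of_ne (dotProduct_self_nonneg v) (Ne.symm (by simpa using hv0))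
    have hSv : 0 < v ⬝ᵥ (S *ᵥ v) := by simpa using hS.dotProduct_mulVec_pos hv0
    -- On a singular Gram matrix the ridge trace grows at least like `1 / τ`, which contradicts
    -- frequent boundedness.
    have hlow (k) : (τ k)⁻¹ * (v ⬝ᵥ (S *ᵥ v)) / (v ⬝ᵥ v) ≤ ((ridgeGram (τ k) x)⁻¹ * S).trace := by
      have h1 : ridgeGram (τ k) x *ᵥ v = τ k • v := by
        rw [ridgeGram, ← hA, Matrix.add_mulVec, hv, Matrix.smul_mulVec, Matrix.one_mulVec, zero_add]
      have h2 : (ridgeGram (τ k) x)⁻¹ *ᵥ v = (τ k)⁻¹ • v := by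
        have := congrArg (fun z => (τ k)⁻¹ • ((ridgeGram (τ k) x)⁻¹ *ᵥ z)) h1
        simp only [Matrix.mulVec_mulVec, Matrix.nonsing_inv_mul _ (isUnit_det_ridgeGram (hτ k) x),
          Matrix.one_mulVec, Matrix.mulVec_smul, smul_smul, inv_mul_cancel₀ (hτ k).ne',
          one_smul] at this
        exact this.symm
      obtain ⟨N, u, hu⟩ := Matrix.posSemidef_iff_eq_sum_vecMulVec.1 hS.posSemidef
      rw [hu, trace_mul_sum_vecMulVec, quad_sum_vecMulVec, Finset.mul_sum, Finset.sum_div]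
      exact Finset.sum_le_sum fun i _ =>
        quad_ge_of_eigenvector (posDef_ridgeGram (hτ k) x).inv.posSemidef h2 hv0 (u i)
    have hlim2 : Tendsto (fun k => t * (v ⬝ᵥ v) * τ k) atTop (𝓝 0) := by
      simpa using hlim.const_mul (t * (v ⬝ᵥ v))
    obtain ⟨k, hk1, hk2⟩ := (hf.and_eventually (hlim2.eventually_lt_const hSv)).exists
    have h3 := (hlow k).trans hk1
    rw [div_le_iff₀ hvv, inv_mul_le_iff₀ (hτ k)] at h3
    linarith
  refine ⟨hunit, ?_⟩
  have hc : Tendsto (fun k => ((ridgeGram (τ k) x)⁻¹ * S).trace) atTop (𝓝 (A⁻¹ * S).trace) := by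
    have hr : Continuous fun s : ℝ => A + s • (1 : Matrix (Fin d) (Fin d) ℝ) := by fun_prop
    have hcont : ContinuousAt
        (fun s : ℝ => ((A + s • (1 : Matrix (Fin d) (Fin d) ℝ))⁻¹ * S).trace) 0 := by
      simp only [Matrix.inv_def, Ring.inverse_eq_inv', Matrix.smul_mul, Matrix.trace_smul,
        smul_eq_mul]
      refine ContinuousAt.mul (hr.matrix_det.continuousAt.inv₀ (by simpa using hunit)) ?_
      exact (hr.matrix_adjugate.matrix_mul continuous_const).matrix_trace.continuousAt
    have := hcont.tendsto.comp hlim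
    simpa [Function.comp_def, ridgeGram, hA] using this
  by_contra hlt
  push Not at hlt
  obtain ⟨k, hk1, hk2⟩ := (hf.and_eventually (hc.eventually_const_lt hlt)).exists
  linarith

variable {μ : Measure (Fin d → ℝ)} [IsProbabilityMeasure μ] [IsGaussian μ]
  {S : Matrix (Fin d) (Fin d) ℝ}

lemma ridgeTrace_nonneg (hS : S.PosDef) {τ : ℝ} (hτ : 0 < τ) (x : Fin n → Fin d → ℝ) :
    0 ≤ ((ridgeGram τ x)⁻¹ * S).trace := by
  obtain ⟨N, u, hu⟩ := Matrix.posSemidef_iff_eq_sum_vecMulVec.1 hS.posSemidef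
  rw [hu, trace_mul_sum_vecMulVec]
  exact Finset.sum_nonneg fun i _ => by
    simpa using (posDef_ridgeGram hτ x).inv.posSemidef.dotProduct_mulVec_nonneg (u i)

/-- Markov's inequality for the saturated trace `T / (4(1 + T))`, which increases with `T`. The
bound does not depend on `τ`. -/
lemma measure_ridgeTrace_gt_le (hS : S.PosDef) (hμ : ∀ k l, ∫ x, x k * x l ∂μ = S k l)
    {τ : ℝ} (hτ : 0 < τ) {t : ℝ} (ht : 0 < t) :
    (Measure.pi fun _ : Fin n => μ).real {x | t < ((ridgeGram τ x)⁻¹ * S).trace} ≤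
      4 * (1 + t) / t * (d / (n + 1)) := by
  set π := Measure.pi fun _ : Fin n => μ
  set f : (Fin n → Fin d → ℝ) → ℝ := fun x =>
    ((ridgeGram τ x)⁻¹ * S).trace / (4 * (1 + ((ridgeGram τ x)⁻¹ * S).trace)) with hf
  have hm : Measurable fun x : Fin n → Fin d → ℝ => ((ridgeGram τ x)⁻¹ * S).trace :=
    measurable_trace (measurable_mul_entries (measurable_ridgeGram_inv τ)
      fun i j => measurable_const)
  have hf0 (x) : 0 ≤ f x :=
    div_nonneg (ridgeTrace_nonneg hS hτ x) (by linarith [ridgeTrace_nonneg hS hτ x])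
  have hint : Integrable f π := by
    refine Integrable.of_bound (hm.div ((hm.const_add 1).const_mul 4)).aestronglyMeasurable 1
      (Eventually.of_forall fun x => ?_)
    rw [Real.norm_of_nonneg (hf0 x)]
    exact div_le_one_of_le₀ (by linarith [ridgeTrace_nonneg hS hτ x])
      (by linarith [ridgeTrace_nonneg hS hτ x])
  have h1 := mul_meas_ge_le_integral_of_nonneg (Eventually.of_forall hf0) hint (t / (4 * (1 + t)))
  have h2 := integral_ridgeTrace_le (n := n) hμ hτ
  have h3 : π.real {x | t < ((ridgeGram τ x)⁻¹ * S).trace}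
      ≤ π.real {x | t / (4 * (1 + t)) ≤ f x} := by
    refine measureReal_mono fun x hx => ?_
    simp only [Set.mem_ofPred_eq, hf] at hx ⊢
    rw [div_le_div_iff₀ (by linarith) (by linarith)]
    nlinarith
  have h4 : t / (4 * (1 + t)) * π.real {x | t < ((ridgeGram τ x)⁻¹ * S).trace}
      ≤ d / (n + 1) :=
    (mul_le_mul_of_nonneg_left h3 (by positivity)).trans (h1.trans h2)
  rw [div_mul_eq_mul_div, div_le_iff₀ (by positivity)] at h4
  rw [div_mul_eq_mul_div, le_div_iff₀ ht]
  linarith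

/-- With `n ≫ d` rows, the Gram matrix of a Gaussian design is invertible and
`tr ((Xᵀ X)⁻¹ S)` is small, with high probability. -/
lemma measure_not_gram_good_le (hS : S.PosDef) (hμ : ∀ k l, ∫ x, x k * x l ∂μ = S k l)
    {t : ℝ} (ht : 0 < t) :
    (Measure.pi fun _ : Fin n => μ).real
        {x | ¬ (IsUnit ((Matrix.of x)ᵀ * Matrix.of x).det ∧
          (((Matrix.of x)ᵀ * Matrix.of x)⁻¹ * S).trace ≤ t)} ≤
      4 * (1 + t) / t * (d / (n + 1)) := by
  set π := Measure.pi fun _ : Fin n => μ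
  set τ : ℕ → ℝ := fun k => 1 / ((k : ℝ) + 1) with hτ
  have hτ0 (k) : 0 < τ k := by positivity
  set B : ℕ → Set (Fin n → Fin d → ℝ) := fun k => {x | t < ((ridgeGram (τ k) x)⁻¹ * S).trace}
  have hb (k) : π.real (B k) ≤ 4 * (1 + t) / t * (d / (n + 1)) :=
    measure_ridgeTrace_gt_le hS hμ (hτ0 k) ht
  -- Failure of the conclusion forces all sufficiently late ridge traces above `t`. This event is an
  -- increasing union of intersections, each inside some `B m`, so continuity from below preserves
  -- the uniform bound.
  have hsub : {x | ¬ (IsUnit ((Matrix.of x)ᵀ * Matrix.of x).det ∧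
      (((Matrix.of x)ᵀ * Matrix.of x)⁻¹ * S).trace ≤ t)} ⊆ ⋃ m, ⋂ k, ⋂ (_ : m ≤ k), B k := by
    intro x hx
    by_contra hx'
    refine hx (isUnit_and_trace_le_of_frequently hS x hτ0 tendsto_one_div_add_atTop_nhds_zero_nat ?_)
    rw [frequently_atTop]
    intro m
    simp only [Set.mem_iUnion, Set.mem_iInter, not_exists, not_forall] at hx'
    obtain ⟨k, hk, hk'⟩ := hx' m
    exact ⟨k, hk, not_lt.1 hk'⟩
  refine (measureReal_mono hsub).trans ?_
  have hmono : Monotone fun m => ⋂ k, ⋂ (_ : m ≤ k), B k := fun a b hab =>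
    Set.iInter_mono fun k => Set.iInter_mono' fun hk => ⟨hab.trans hk, le_rfl⟩
  have hlim := tendsto_measure_iUnion_atTop (μ := π) hmono
  have hlim' := (ENNReal.tendsto_toReal (measure_ne_top π _)).comp hlim
  refine le_of_tendsto hlim' (Eventually.of_forall fun m => ?_)
  exact (measureReal_mono (μ := π) (Set.iInter₂_subset m le_rfl)).trans (hb m)

end InverseGramTrace

/-! ### White noise: quadratic forms, regrouping of independence, and norms. -/

section Noise

variable {Ω : Type*} [MeasurableSpace Ω] {P : Measure Ω} [IsProbabilityMeasure P]

/-- A quadratic form in white noise, with coefficients independent of the noise, is controlled by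
the trace of its matrix. -/
lemma measure_quad_gt_le {n : ℕ} {𝒲 : Type*} [MeasurableSpace 𝒲] {W : Ω → 𝒲}
    {e : Ω → Fin n → ℝ} (hW : Measurable W) (he : Measurable e) (hind : IndepFun W e P) {v : ℝ}
    (hv : 0 ≤ v) (hint : ∀ i j, Integrable (fun ω => e ω i * e ω j) P)
    (hmom : ∀ i j, ∫ ω, e ω i * e ω j ∂P = if i = j then v else 0)
    {A : 𝒲 → Matrix (Fin n) (Fin n) ℝ} (hAm : ∀ i j, Measurable fun w => A w i j)
    (hA : ∀ w, (A w).PosSemidef) {t s : ℝ} (ht : 0 ≤ t) (hs : 0 < s) :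
    P.real {ω | (A (W ω)).trace ≤ t ∧ s < e ω ⬝ᵥ (A (W ω) *ᵥ e ω)} ≤ v * t / s := by
  set B : Set (𝒲 × (Fin n → ℝ)) := {p | (A p.1).trace ≤ t ∧ s < p.2 ⬝ᵥ (A p.1 *ᵥ p.2)} with hB
  have hBm : MeasurableSet B := by
    refine MeasurableSet.inter ?_ ?_
    · exact measurableSet_le (measurable_trace fun i j => (hAm i j).comp measurable_fst)
        measurable_const
    · refine measurableSet_lt measurable_const (measurable_dotProduct (fun i => by fun_prop)
        (measurable_mulVec_entries (fun i j => (hAm i j).comp measurable_fst)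
          fun i => by fun_prop))
  have hlaw := (indepFun_iff_map_prod_eq_prod_map_map hW.aemeasurable he.aemeasurable).1 hind
  have : IsProbabilityMeasure (P.map e) := Measure.isProbabilityMeasure_map he.aemeasurable
  have : IsProbabilityMeasure (P.map W) := Measure.isProbabilityMeasure_map hW.aemeasurable
  -- By independence the matrix can be frozen. A fibre with trace above `t` is empty; otherwise the
  -- form has mean `v * trace` and Markov's inequality applies.
  have hfib (w : 𝒲) : (P.map e) (Prod.mk w ⁻¹' B) ≤ ENNReal.ofReal (v * t / s) := by
    by_cases hw : (A w).trace ≤ t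
    swap
    · have : Prod.mk w ⁻¹' B = ∅ := by ext; simp [hB, hw]
      simp [this]
    have hq : Measurable fun x : Fin n → ℝ => x ⬝ᵥ (A w *ᵥ x) :=
      measurable_dotProduct (fun i => by fun_prop)
        (measurable_mulVec_entries (fun i j => measurable_const) fun i => by fun_prop)
    rw [Measure.map_apply he (measurable_prodMk_left hBm)]
    have hsub : e ⁻¹' (Prod.mk w ⁻¹' B) ⊆ {ω | s ≤ e ω ⬝ᵥ (A w *ᵥ e ω)} := fun ω hω => hω.2.le
    have hi : Integrable (fun ω => e ω ⬝ᵥ (A w *ᵥ e ω)) P := by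
      simp only [quad_eq_sum]
      exact integrable_finsetSum _ fun k _ => integrable_finsetSum _ fun l _ =>
        (hint l k).const_mul _
    have hE : ∫ ω, e ω ⬝ᵥ (A w *ᵥ e ω) ∂P = v * (A w).trace := by
      simp only [quad_eq_sum]
      refine (integral_finsetSum _ fun k _ => integrable_finsetSum _ fun l _ =>
        (hint l k).const_mul _).trans ?_
      simp only [Matrix.trace, Matrix.diag, Finset.mul_sum]
      refine Finset.sum_congr rfl fun k _ => ?_
      rw [integral_finsetSum _ fun l _ => (hint l k).const_mul _]
      simp only [integral_const_mul, hmom]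
      simp [mul_comm]
    have hmk := mul_meas_ge_le_integral_of_nonneg
      (Eventually.of_forall fun ω => by simpa using (hA w).dotProduct_mulVec_nonneg (e ω)) hi s
    rw [hE] at hmk
    refine (measure_mono hsub).trans ?_
    rw [← ofReal_measureReal]
    refine ENNReal.ofReal_le_ofReal ?_
    rw [le_div_iff₀ hs, mul_comm]
    exact hmk.trans (mul_le_mul_of_nonneg_left hw hv)
  have h1 : P {ω | (A (W ω)).trace ≤ t ∧ s < e ω ⬝ᵥ (A (W ω) *ᵥ e ω)}
      = ((P.map W).prod (P.map e)) B := by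
    rw [← hlaw, Measure.map_apply (hW.prodMk he) hBm]; rfl
  have h2 : ((P.map W).prod (P.map e)) B ≤ ENNReal.ofReal (v * t / s) := by
    rw [Measure.prod_apply hBm]
    refine (lintegral_mono hfib).trans (by simp)
  rw [measureReal_def, h1]
  exact ENNReal.toReal_le_of_le_ofReal (by positivity) h2

/-- The hypotheses factor the joint law of `(U, V, W)` completely; reassociating the product measure
gives the claim. -/
lemma indepFun_prodMk_left {α β γ : Type*} [MeasurableSpace α] [MeasurableSpace β]
    [MeasurableSpace γ] {U : Ω → α} {V : Ω → β} {W : Ω → γ} (hU : Measurable U)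
    (hV : Measurable V) (hW : Measurable W) (h1 : IndepFun U (fun ω => (V ω, W ω)) P)
    (h2 : IndepFun V W P) : IndepFun (fun ω => (U ω, V ω)) W P := by
  have := Measure.isProbabilityMeasure_map (μ := P) hU.aemeasurable
  have := Measure.isProbabilityMeasure_map (μ := P) hV.aemeasurable
  have := Measure.isProbabilityMeasure_map (μ := P) hW.aemeasurable
  have hUV : IndepFun U V P := h1.comp measurable_id measurable_fst
  rw [indepFun_iff_map_prod_eq_prod_map_map (by fun_prop) (by fun_prop)] at h1 h2 hUV ⊢
  have h3 := (measurePreserving_prodAssoc (P.map U) (P.map V) (P.map W)).symm.map_eq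
  rw [hUV, ← h3, ← h2, ← h1, Measure.map_map (MeasurableEquiv.measurable _) (by fun_prop)]
  rfl

/-- Two independent pairs of independent variables may be regrouped. -/
lemma indepFun_prodMk_prodMk {α α' β β' : Type*} [MeasurableSpace α] [MeasurableSpace α']
    [MeasurableSpace β] [MeasurableSpace β'] {U : Ω → α} {U' : Ω → α'} {V : Ω → β} {V' : Ω → β'}
    (hU : Measurable U) (hU' : Measurable U') (hV : Measurable V) (hV' : Measurable V')
    (h : IndepFun (fun ω => (U ω, U' ω)) (fun ω => (V ω, V' ω)) P)
    (h1 : IndepFun U U' P) (h2 : IndepFun V V' P) :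
    IndepFun (fun ω => (U ω, V ω)) (fun ω => (U' ω, V' ω)) P := by
  have h3 : IndepFun (fun ω => (V' ω, U' ω)) (fun ω => (U ω, V ω)) P := by
    refine indepFun_prodMk_left hV' hU' (by fun_prop) ?_ ?_
    · exact (indepFun_prodMk_left (by fun_prop) hV hV' h h2).symm.comp measurable_id
        (ψ := fun p : (α × α') × β => (p.1.2, (p.1.1, p.2))) (by fun_prop)
    · exact (indepFun_prodMk_left (by fun_prop) hU hU' h.symm h1).symm.comp measurable_id
        (ψ := fun p : (β × β') × α => (p.2, p.1.1)) (by fun_prop)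
  exact h3.symm.comp measurable_id measurable_swap

lemma hasLaw_and_iIndepFun_of_pi {ι : Type*} [Fintype ι] {e : ι → Ω → ℝ} {v : NNReal}
    (h : HasLaw (fun ω i => e i ω) (Measure.pi fun _ : ι => gaussianReal 0 v) P) :
    (∀ i, HasLaw (e i) (gaussianReal 0 v) P) ∧ iIndepFun e P := by
  have h1 (i) : HasLaw (e i) (gaussianReal 0 v) P :=
    (measurePreserving_eval (fun _ : ι => gaussianReal 0 v) i).fun_comp_hasLaw h
  exact ⟨h1, (iIndepFun_iff_hasLaw_pi_pi h1).2 h⟩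

lemma integral_sq_of_hasLaw {y : Ω → ℝ} {v : NNReal} (h : HasLaw y (gaussianReal 0 v) P) :
    ∫ ω, y ω ^ 2 ∂P = v := by
  have := h.integral_comp (f := fun x : ℝ => x ^ 2) (by fun_prop)
  rw [integral_sq_gaussianReal] at this
  simpa using this

lemma integral_of_hasLaw {y : Ω → ℝ} {v : NNReal} (h : HasLaw y (gaussianReal 0 v) P) :
    ∫ ω, y ω ∂P = 0 := by
  rw [h.integral_eq, integral_id_gaussianReal]

lemma integrable_mul_noise {ι : Type*} [Fintype ι] {e : ι → Ω → ℝ} {v : NNReal}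
    (h : HasLaw (fun ω i => e i ω) (Measure.pi fun _ : ι => gaussianReal 0 v) P) (i j : ι) :
    Integrable (fun ω => e i ω * e j ω) P := by
  have h1 := (hasLaw_and_iIndepFun_of_pi h).1
  exact (h1 i).hasGaussianLaw.memLp_two.integrable_mul (h1 j).hasGaussianLaw.memLp_two

lemma integral_mul_noise {ι : Type*} [Fintype ι] [DecidableEq ι] {e : ι → Ω → ℝ} {v : NNReal}
    (h : HasLaw (fun ω i => e i ω) (Measure.pi fun _ : ι => gaussianReal 0 v) P) (i j : ι) :
    ∫ ω, e i ω * e j ω ∂P = if i = j then (v : ℝ) else 0 := by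
  obtain ⟨h1, h2⟩ := hasLaw_and_iIndepFun_of_pi h
  split_ifs with hij
  · subst hij
    simp only [← pow_two]
    exact integral_sq_of_hasLaw (h1 i)
  · rw [(h2.indepFun hij).integral_fun_mul_eq_mul_integral (h1 i).aemeasurable.aestronglyMeasurable
      (h1 j).aemeasurable.aestronglyMeasurable, integral_of_hasLaw (h1 i), zero_mul]

/-- The squared norm of `n` independent `N(0, v)` variables is at least `n v / 2` with high
probability. -/
lemma measure_sum_sq_lt_le {n : ℕ} (hn : 0 < n) {e : Fin n → Ω → ℝ} {v : NNReal} (hv : 0 < v)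
    (hlaw : ∀ i, HasLaw (e i) (gaussianReal 0 v) P) (hind : iIndepFun e P) :
    P.real {ω | ∑ i, e i ω ^ 2 < n * v / 2} ≤ 8 / n := by
  have hm (i) : MemLp (fun ω => e i ω ^ 2) 2 P := by
    refine (memLp_two_iff_integrable_sq
      ((hlaw i).aemeasurable.pow_const 2).aestronglyMeasurable).2 ?_
    simp only [← pow_mul]
    exact integrable_pow_of_gaussian (hlaw i).hasGaussianLaw 4
  have hvar1 (i) : Var[fun ω => e i ω ^ 2; P] ≤ 2 * (v : ℝ) ^ 2 := by
    rw [variance_eq_sub (hm i), integral_sq_of_hasLaw (hlaw i)]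
    have := integral_pow_four_le (hlaw i).hasGaussianLaw
    rw [integral_sq_of_hasLaw (hlaw i)] at this
    simp only [Pi.pow_apply, ← pow_mul]
    norm_num
    linarith
  have hvar : Var[∑ i, fun ω => e i ω ^ 2; P] ≤ n * (2 * (v : ℝ) ^ 2) := by
    rw [IndepFun.variance_sum (fun i _ => hm i) fun i _ j _ hij =>
      (hind.indepFun hij).comp (φ := fun x : ℝ => x ^ 2) (ψ := fun x : ℝ => x ^ 2)
        (by fun_prop) (by fun_prop)]
    refine (Finset.sum_le_sum fun i _ => hvar1 i).trans (by simp)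
  have hmean : ∫ ω, (∑ i, fun ω => e i ω ^ 2) ω ∂P = n * v := by
    simp only [Finset.sum_apply]
    rw [integral_finsetSum _ fun i _ => (hm i).integrable (by norm_num)]
    simp [integral_sq_of_hasLaw (hlaw _)]
  have hn' : (0 : ℝ) < n := by exact_mod_cast hn
  have hv' : (0 : ℝ) < v := by exact_mod_cast hv
  have hc : (0 : ℝ) < n * v / 2 := by positivity
  -- Chebyshev with variance at most `2nv²` and deviation `nv / 2` gives `8 / n`.
  have hch := meas_ge_le_variance_div_sq (memLp_finsetSum' Finset.univ fun i _ => hm i) hc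
  rw [hmean] at hch
  have hsub : {ω | ∑ i, e i ω ^ 2 < n * v / 2} ⊆
      {ω | n * v / 2 ≤ |(∑ i, fun ω => e i ω ^ 2) ω - n * v|} := by
    intro ω hω
    simp only [Set.mem_ofPred_eq, Finset.sum_apply] at hω ⊢
    rw [le_abs]; right; linarith
  refine (measureReal_mono hsub).trans ?_
  refine ENNReal.toReal_le_of_le_ofReal (by positivity) (hch.trans (ENNReal.ofReal_le_ofReal ?_))
  rw [div_le_div_iff₀ (by positivity) hn']
  nlinarith

end Noise

/-! ### Deterministic bounds on the good event. -/

namespace Sample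

variable {d n : ℕ}

/-- The Stage I residuals. -/
noncomputable def resid (a : Sample d n) : Fin n → ℝ := (1 - hat a.X0) *ᵥ a.eps0

/-- The part of the Stage I residuals orthogonal to the post-recourse design. -/
noncomputable def orthResid (a : Sample d n) : Fin n → ℝ := (1 - hat a.X) *ᵥ a.resid

/-- The event on which the two-stage estimator is controlled, with constant `C`. -/
structure Good (σ C : ℝ) (S0 S : Matrix (Fin d) (Fin d) ℝ) (a : Sample d n) : Prop where
  isUnit_X0 : IsUnit (a.X0ᵀ * a.X0).det
  isUnit_X : IsUnit (a.Xᵀ * a.X).det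
  norm_eps0 : n * σ ^ 2 / 2 ≤ ∑ i, a.eps0 i ^ 2
  hat_eps0 : a.eps0 ⬝ᵥ (hat a.X0 *ᵥ a.eps0) ≤ C * d
  hat_resid : a.eps0 ⬝ᵥ (((1 - hat a.X0) * hat a.X * (1 - hat a.X0)) *ᵥ a.eps0) ≤ C * d
  coef_eps0 : a.eps0 ⬝ᵥ (((lsq a.X)ᵀ * S * lsq a.X) *ᵥ a.eps0) ≤ C * (d / n)
  coef_epsBar : a.epsBar ⬝ᵥ (((lsq a.X)ᵀ * S * lsq a.X) *ᵥ a.epsBar) ≤ C * (d / n)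
  coef_resid : a.eps0 ⬝ᵥ (((1 - hat a.X0) * ((lsq a.X)ᵀ * S * lsq a.X) * (1 - hat a.X0)) *ᵥ
    a.eps0) ≤ C * (d / n)
  coef0_eps0 : a.eps0 ⬝ᵥ (((lsq a.X0)ᵀ * S0 * lsq a.X0) *ᵥ a.eps0) ≤ C * (d / n)
  cross : a.epsBar ⬝ᵥ (((a.orthResid ⬝ᵥ a.orthResid)⁻¹ •
    Matrix.vecMulVec a.orthResid a.orthResid) *ᵥ a.epsBar) ≤ C

lemma compl_conj_quad (A H : Matrix (Fin n) (Fin n) ℝ) (hH : Hᵀ = H) (v : Fin n → ℝ) :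
    v ⬝ᵥ (((1 - H) * A * (1 - H)) *ᵥ v) = ((1 - H) *ᵥ v) ⬝ᵥ (A *ᵥ ((1 - H) *ᵥ v)) := by
  have := dotProduct_conj_mulVec (1 - H) A v
  rwa [Matrix.transpose_sub, hH, Matrix.transpose_one] at this

variable {σ ρ C : ℝ} {S0 S : Matrix (Fin d) (Fin d) ℝ} {a : Sample d n}

lemma betaHat_eq (h : IsUnit (a.Xᵀ * a.X).det) (β : Fin d → ℝ) :
    a.betaHat ρ β = β + lsq a.X *ᵥ a.eps ρ := ols_sub h β _

lemma betaHat0_eq (h : IsUnit (a.X0ᵀ * a.X0).det) (β0 : Fin d → ℝ) :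
    a.betaHat0 β0 = β0 + lsq a.X0 *ᵥ a.eps0 := ols_sub h β0 _

lemma augDesign_betaHat0 (h : IsUnit (a.X0ᵀ * a.X0).det) (β0 : Fin d → ℝ) :
    a.augDesign β0 (a.betaHat0 β0) = appendCol a.X a.resid := by
  rw [augDesign, betaHat0_eq h, Y0, Matrix.mulVec_add, Matrix.mulVec_mulVec, resid,
    Matrix.sub_mulVec, Matrix.one_mulVec]
  congr 1
  rw [hat]
  abel

lemma Good.coef_eps (hS : S.PosSemidef) (hρ : |ρ| ≤ 1) (hg : Good σ C S0 S a) (hC : 0 ≤ C) :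
    (lsq a.X *ᵥ a.eps ρ) ⬝ᵥ (S *ᵥ (lsq a.X *ᵥ a.eps ρ)) ≤ 4 * C * (d / n) := by
  have hρ2 : ρ ^ 2 ≤ 1 := by rw [← sq_abs]; exact pow_le_one₀ (abs_nonneg _) hρ
  have h1 := hg.coef_eps0
  have h2 := hg.coef_epsBar
  rw [dotProduct_conj_mulVec] at h1 h2
  rw [eps, Matrix.mulVec_add, Matrix.mulVec_smul, Matrix.mulVec_smul]
  refine (posSemidef_add_quad hS _ _).trans ?_
  rw [smul_quad, smul_quad, Real.sq_sqrt (by linarith)]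
  have h3 : 0 ≤ C * ((d : ℝ) / n) := by positivity
  nlinarith [sq_nonneg ρ, mul_le_mul_of_nonneg_left h1 (sq_nonneg ρ),
    mul_le_mul_of_nonneg_left h2 (sub_nonneg.2 hρ2)]

/-- The excess risk of the single-stage estimator on the good event. -/
lemma Good.std_excess_le (hS : S.PosSemidef) (hρ : |ρ| ≤ 1) (hg : Good σ C S0 S a) (hC : 0 ≤ C)
    (β : Fin d → ℝ) :
    (β - a.betaHat ρ β) ⬝ᵥ (S *ᵥ (β - a.betaHat ρ β)) ≤ 4 * C * (d / n) := by
  have : β - a.betaHat ρ β = (-1 : ℝ) • (lsq a.X *ᵥ a.eps ρ) := by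
    rw [betaHat_eq hg.isUnit_X]; simp
  rw [this, smul_quad]
  simpa using hg.coef_eps hS hρ hC

/-- `ε₀` is the sum of `orthResid` and the two parts removed by projection, each of squared norm at
most `C d`. Hence `‖w‖² ≥ nσ²/6 - 2Cd`, and `hK` bounds `2Cd` by `nσ²/12`. -/
lemma Good.orthResid_sq_ge (hg : Good σ C S0 S a) (hK : 24 * C * d ≤ n * σ ^ 2) :
    n * σ ^ 2 / 12 ≤ a.orthResid ⬝ᵥ a.orthResid := by
  have h1 := hg.hat_eps0
  have h2 := hg.hat_resid
  rw [dotProduct_hat_mulVec] at h1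
  rw [compl_conj_quad _ _ (hat_transpose _), dotProduct_hat_mulVec] at h2
  have h3 := hg.norm_eps0
  have e : a.eps0 = a.orthResid + hat a.X0 *ᵥ a.eps0 + hat a.X *ᵥ a.resid := by
    simp only [orthResid, Matrix.sub_mulVec, Matrix.one_mulVec]
    simp only [resid, Matrix.sub_mulVec, Matrix.one_mulVec]
    abel
  have h4 := dotProduct_self_add_le a.orthResid (hat a.X0 *ᵥ a.eps0) (hat a.X *ᵥ a.resid)
  rw [← e] at h4
  have h5 : ∑ i, a.eps0 i ^ 2 = a.eps0 ⬝ᵥ a.eps0 := by simp [dotProduct, pow_two]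
  rw [← resid] at h2
  linarith

/-- The excess risk of the two-stage estimator on the good event. -/
lemma Good.aug_excess_le (hS : S.PosSemidef) (hσ : 0 < σ) (hρ : |ρ| ≤ 1)
    (hg : Good σ C S0 S a) (hC : 0 ≤ C) (hd : 0 < d) (hn : 0 < n) (hK : 24 * C * d ≤ n * σ ^ 2)
    (β0 β : Fin d → ℝ) :
    let c := a.betaHatC ρ β0 β
    σ ^ 2 * (ρ - c (Sum.inr ())) ^ 2 +
      2 * ((β - c ∘ Sum.inl) ⬝ᵥ (S *ᵥ (β - c ∘ Sum.inl))) +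
      2 * ((c (Sum.inr ()) • (a.betaHat0 β0 - β0)) ⬝ᵥ
        (S0 *ᵥ (c (Sum.inr ()) • (a.betaHat0 β0 - β0)))) ≤ 100 * C * (d / n) := by
  intro c
  have hn' : (0 : ℝ) < n := by exact_mod_cast hn
  have hd' : (1 : ℝ) ≤ d := by exact_mod_cast hd
  have hρ2 : ρ ^ 2 ≤ 1 := by rw [← sq_abs]; exact pow_le_one₀ (abs_nonneg _) hρ
  set x : ℝ := d / n with hx
  have hx0 : 0 ≤ x := by positivity
  set w := a.orthResid with hw
  set q := w ⬝ᵥ w with hq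
  have hq1 : n * σ ^ 2 / 12 ≤ q := hg.orthResid_sq_ge hK
  have hq0 : 0 < q := lt_of_lt_of_le (by positivity) hq1
  obtain ⟨hb, hγ⟩ := ols_appendCol hg.isUnit_X a.resid (a.eps ρ) w β rfl hq0
  rw [← augDesign_betaHat0 hg.isUnit_X0 β0] at hb hγ
  change c ∘ Sum.inl = β + lsq a.X *ᵥ (a.eps ρ - c (Sum.inr ()) • a.resid) at hb
  change c (Sum.inr ()) * q = w ⬝ᵥ a.eps ρ at hγ
  set γ := c (Sum.inr ()) with hγdef
  have hwr : w ⬝ᵥ a.resid = q := by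
    have h1 : a.resid = w + hat a.X *ᵥ a.resid := by
      rw [hw, orthResid, Matrix.sub_mulVec, Matrix.one_mulVec]; abel
    have h2 : w ⬝ᵥ (hat a.X *ᵥ a.resid) = 0 := by
      rw [Matrix.dotProduct_mulVec, ← Matrix.mulVec_transpose, hat_transpose, hw, orthResid,
        Matrix.mulVec_mulVec, Matrix.mul_sub, hat_mul_hat]
      simp
    nth_rw 1 [h1]
    rw [dotProduct_add, h2, add_zero]
  have hwe0 : w ⬝ᵥ a.eps0 = q + w ⬝ᵥ (hat a.X0 *ᵥ a.eps0) := by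
    have h1 : a.eps0 = a.resid + hat a.X0 *ᵥ a.eps0 := by
      rw [resid, Matrix.sub_mulVec, Matrix.one_mulVec]; abel
    nth_rw 1 [h1]
    rw [dotProduct_add, hwr]
  -- Since `w · ε₀ = q + w · (hat X0 ε₀)`, the leading term `ρ q` cancels and only fluctuations
  -- remain.
  have hγρ : (γ - ρ) * q = ρ * (w ⬝ᵥ (hat a.X0 *ᵥ a.eps0)) + √(1 - ρ ^ 2) * (w ⬝ᵥ a.epsBar) := by
    rw [sub_mul, hγ, eps, dotProduct_add, dotProduct_smul, dotProduct_smul, hwe0]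
    simp only [smul_eq_mul]; ring
  have h1 : (w ⬝ᵥ (hat a.X0 *ᵥ a.eps0)) ^ 2 ≤ q * (C * d) := by
    refine (dotProduct_sq_le _ _).trans (mul_le_mul_of_nonneg_left ?_ hq0.le)
    rw [← dotProduct_hat_mulVec]
    exact hg.hat_eps0
  have h2 : (w ⬝ᵥ a.epsBar) ^ 2 ≤ q * C := by
    have := hg.cross
    rw [Matrix.smul_mulVec, Matrix.vecMulVec_mulVec, dotProduct_smul, dotProduct_smul, ← hw, ← hq,
      smul_eq_mul] at this
    have e : MulOpposite.op (w ⬝ᵥ a.epsBar) • (a.epsBar ⬝ᵥ w) = (w ⬝ᵥ a.epsBar) ^ 2 := by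
      rw [op_smul_eq_mul, dotProduct_comm a.epsBar w, pow_two]
    rw [e, inv_mul_le_iff₀ hq0] at this
    exact this
  have h3 : (γ - ρ) ^ 2 * q ≤ 4 * C * d := by
    have hs : √(1 - ρ ^ 2) ^ 2 ≤ 1 := by
      rw [Real.sq_sqrt (by linarith)]; linarith [sq_nonneg ρ]
    have e1 : ((γ - ρ) * q) ^ 2 ≤ 2 * (ρ ^ 2 * (w ⬝ᵥ (hat a.X0 *ᵥ a.eps0)) ^ 2) +
        2 * (√(1 - ρ ^ 2) ^ 2 * (w ⬝ᵥ a.epsBar) ^ 2) := by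
      rw [hγρ]
      nlinarith [sq_nonneg (ρ * (w ⬝ᵥ (hat a.X0 *ᵥ a.eps0)) - √(1 - ρ ^ 2) * (w ⬝ᵥ a.epsBar))]
    have e2 : ρ ^ 2 * (w ⬝ᵥ (hat a.X0 *ᵥ a.eps0)) ^ 2 ≤ q * (C * d) :=
      (mul_le_of_le_one_left (sq_nonneg _) hρ2).trans h1
    have e3 : √(1 - ρ ^ 2) ^ 2 * (w ⬝ᵥ a.epsBar) ^ 2 ≤ q * C :=
      (mul_le_of_le_one_left (sq_nonneg _) hs).trans h2
    -- The `ε̄` term carries no factor `d`; `1 ≤ d` lets both terms share one bound.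
    have e4 : q * C ≤ q * (C * d) :=
      mul_le_mul_of_nonneg_left (le_mul_of_one_le_right hC hd') hq0.le
    have e5 : q * ((γ - ρ) ^ 2 * q) ≤ q * (4 * C * d) := by nlinarith
    exact le_of_mul_le_mul_left e5 hq0
  have h4 : σ ^ 2 * (γ - ρ) ^ 2 ≤ 48 * C * x := by
    have e1 : (γ - ρ) ^ 2 * (n * σ ^ 2 / 12) ≤ 4 * C * d :=
      (mul_le_mul_of_nonneg_left hq1 (sq_nonneg _)).trans h3
    rw [hx, ← mul_div_assoc, le_div_iff₀ hn']
    linarith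
  have hCx : 24 * (C * x) ≤ σ ^ 2 := by
    rw [hx, ← mul_div_assoc, ← mul_div_assoc, div_le_iff₀ hn']
    linarith
  -- `48 C x ≤ 2σ²` gives `(γ - ρ)² ≤ 2`, and `γ² ≤ 2ρ² + 2(γ - ρ)²`.
  have h5 : γ ^ 2 ≤ 6 := by
    have hσ2 : 0 < σ ^ 2 := by positivity
    have : σ ^ 2 * (γ - ρ) ^ 2 ≤ σ ^ 2 * 2 := by linarith
    have := le_of_mul_le_mul_left this hσ2
    nlinarith [sq_nonneg (γ - 2 * ρ)]
  have h6 := hg.coef_eps hS hρ hC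
  have h7 := hg.coef_resid
  rw [compl_conj_quad _ _ (hat_transpose _), ← resid, dotProduct_conj_mulVec] at h7
  have h8 := hg.coef0_eps0
  rw [dotProduct_conj_mulVec] at h8
  have hu : β - c ∘ Sum.inl = (-1 : ℝ) • (lsq a.X *ᵥ a.eps ρ) + γ • (lsq a.X *ᵥ a.resid) := by
    rw [hb, Matrix.mulVec_sub, Matrix.mulVec_smul]
    simp only [neg_smul, one_smul]
    abel
  have h9 : (β - c ∘ Sum.inl) ⬝ᵥ (S *ᵥ (β - c ∘ Sum.inl)) ≤ 20 * (C * x) := by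
    rw [hu]
    refine (posSemidef_add_quad hS _ _).trans ?_
    rw [smul_quad, smul_quad]
    have : γ ^ 2 * ((lsq a.X *ᵥ a.resid) ⬝ᵥ (S *ᵥ (lsq a.X *ᵥ a.resid))) ≤ 6 * (C * x) :=
      (mul_le_mul_of_nonneg_left h7 (sq_nonneg _)).trans
        (mul_le_mul_of_nonneg_right h5 (by positivity))
    linarith
  have h10 : (γ • (a.betaHat0 β0 - β0)) ⬝ᵥ (S0 *ᵥ (γ • (a.betaHat0 β0 - β0))) ≤ 6 * (C * x) := by
    rw [betaHat0_eq hg.isUnit_X0, add_sub_cancel_left, smul_quad]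
    exact (mul_le_mul_of_nonneg_left h8 (sq_nonneg _)).trans
        (mul_le_mul_of_nonneg_right h5 (by positivity))
  -- The constants add up to `48 + 2 · 20 + 2 · 6 = 100`.
  have h11 : (ρ - γ) ^ 2 = (γ - ρ) ^ 2 := by ring
  rw [h11]
  linarith

end Sample

/-! ### Independence of training and test data, and prediction error on one unit. -/

namespace Model

variable {σ ρ : ℝ} (M : Model σ ρ)

lemma coe_noise_var (σ : ℝ) : ((σ ^ 2).toNNReal : ℝ) = σ ^ 2 := Real.coe_toNNReal _ (sq_nonneg _)

@[fun_prop]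
lemma measurable_train : Measurable M.train := by
  have := M.measurable_X0; have := M.measurable_X
  have := M.measurable_eps0; have := M.measurable_epsBar
  unfold train
  fun_prop

@[fun_prop]
lemma measurable_test : Measurable M.test := by
  have := M.measurable_X0; have := M.measurable_X
  have := M.measurable_eps0; have := M.measurable_epsBar
  unfold test
  fun_prop

lemma indepFun_inl_inr {β : Type*} [MeasurableSpace β] {f : Fin M.na ⊕ Fin M.nb → M.Ω → β}
    (hf : ∀ i, Measurable (f i)) (h : iIndepFun f M.P) :
    IndepFun (fun ω (i : Fin M.na) => f (.inl i) ω) (fun ω (j : Fin M.nb) => f (.inr j) ω) M.P := by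
  set s := Finset.univ.filter fun i : Fin M.na ⊕ Fin M.nb => i.isLeft = true
  set t := Finset.univ.filter fun i : Fin M.na ⊕ Fin M.nb => i.isRight = true
  have hd : Disjoint s t := by
    rw [Finset.disjoint_left]
    rintro (i | i) <;> simp [s, t]
  exact (h.indepFun_finset _ _ hd hf).comp
    (φ := fun (g : s → β) (i : Fin M.na) => g ⟨.inl i, by simp [s]⟩)
    (ψ := fun (g : t → β) (i : Fin M.nb) => g ⟨.inr i, by simp [t]⟩) (by fun_prop) (by fun_prop)

/-- Covariates, `ε₀` and `ε̄` each split into independent training and test parts. Regrouping first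
the two noises, then noise with covariates, keeps the split. -/
lemma indepFun_train_test : IndepFun M.train M.test M.P := by
  have hc := M.indepFun_inl_inr (fun i => (M.measurable_X0 i).prodMk (M.measurable_X i)) M.indep_cov
  have h0 := M.indepFun_inl_inr M.measurable_eps0 (hasLaw_and_iIndepFun_of_pi M.law_eps0).2
  have hb := M.indepFun_inl_inr M.measurable_epsBar (hasLaw_and_iIndepFun_of_pi M.law_epsBar).2
  have m0 := M.measurable_X0
  have m1 := M.measurable_X
  have m2 := M.measurable_eps0
  have m3 := M.measurable_epsBar
  have hn := indepFun_prodMk_prodMk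
    (U := fun ω (i : Fin M.na) => M.eps0 (.inl i) ω) (U' := fun ω (i : Fin M.nb) => M.eps0 (.inr i) ω)
    (V := fun ω (i : Fin M.na) => M.epsBar (.inl i) ω)
    (V' := fun ω (i : Fin M.nb) => M.epsBar (.inr i) ω)
    (by fun_prop) (by fun_prop) (by fun_prop) (by fun_prop)
    (M.indep_noise.comp
      (φ := fun g => ((fun i : Fin M.na => g (.inl i)), (fun i : Fin M.nb => g (.inr i))))
      (ψ := fun g => ((fun i : Fin M.na => g (.inl i)), (fun i : Fin M.nb => g (.inr i))))
      (by fun_prop) (by fun_prop)) h0 hb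
  have hall := indepFun_prodMk_prodMk (by fun_prop) (by fun_prop) (by fun_prop) (by fun_prop)
    (M.indep_cov_noise.comp
      (φ := fun g => ((fun i : Fin M.na => g (.inl i)), (fun i : Fin M.nb => g (.inr i))))
      (ψ := fun g => (((fun i : Fin M.na => g.1 (.inl i)), (fun i : Fin M.na => g.2 (.inl i))),
        ((fun i : Fin M.nb => g.1 (.inr i)), (fun i : Fin M.nb => g.2 (.inr i)))))
      (by fun_prop) (by fun_prop)) hc hn
  exact hall.comp
    (φ := fun p : (Fin M.na → (Fin M.d → ℝ) × (Fin M.d → ℝ)) × (Fin M.na → ℝ) × (Fin M.na → ℝ) =>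
      ((fun i => (p.1 i).1, fun i => (p.1 i).2, p.2.1, p.2.2) : Sample M.d M.na))
    (ψ := fun p : (Fin M.nb → (Fin M.d → ℝ) × (Fin M.d → ℝ)) × (Fin M.nb → ℝ) × (Fin M.nb → ℝ) =>
      ((fun i => (p.1 i).1, fun i => (p.1 i).2, p.2.1, p.2.2) : Sample M.d M.nb))
    (by fun_prop) (by fun_prop)

/-- Since the test data are independent of the training data, the conditional risk is the
expected loss over the test data. -/
lemma condRisk_ae_eq {loss : Sample M.d M.na → Sample M.d M.nb → ℝ}
    (hloss : ∀ a, Measurable (loss a)) :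
    M.condRisk loss =ᵐ[M.P] fun ω => ∫ ω', loss (M.train ω) (M.test ω') ∂M.P := by
  have hmt : IsProbabilityMeasure (M.P.map M.test) :=
    Measure.isProbabilityMeasure_map M.measurable_test.aemeasurable
  have hmr : IsProbabilityMeasure (M.P.map M.train) :=
    Measure.isProbabilityMeasure_map M.measurable_train.aemeasurable
  have h1 : condDistrib M.test M.train M.P =ᵐ[M.P.map M.train]
      Kernel.const (Sample M.d M.na) (M.P.map M.test) := by
    refine condDistrib_ae_eq_of_measure_eq_compProd M.train M.measurable_test.aemeasurable ?_
    rw [Measure.compProd_const]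
    exact (indepFun_iff_map_prod_eq_prod_map_map M.measurable_train.aemeasurable
      M.measurable_test.aemeasurable).1 M.indepFun_train_test
  filter_upwards [ae_of_ae_map M.measurable_train.aemeasurable h1] with ω hω
  rw [condRisk, hω, Kernel.const_apply,
    integral_map M.measurable_test.aemeasurable (hloss _).aestronglyMeasurable]

section TestUnit

variable (u v : Fin M.d → ℝ) (g h : ℝ)

lemma hasGaussianLaw_lin (i : Fin M.na ⊕ Fin M.nb) :
    HasGaussianLaw (fun ω => u ⬝ᵥ M.X i ω + v ⬝ᵥ M.X0 i ω) M.P := by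
  have := (M.gaussian_cov i).map_fun
    (((LinearMap.toContinuousLinearMap (dotProductBilin ℝ ℝ u)).comp
      (ContinuousLinearMap.snd ℝ (Fin M.d → ℝ) (Fin M.d → ℝ))) +
      ((LinearMap.toContinuousLinearMap (dotProductBilin ℝ ℝ v)).comp
      (ContinuousLinearMap.fst ℝ (Fin M.d → ℝ) (Fin M.d → ℝ))))
  simpa using this

instance isGaussian_map_X (i : Fin M.na ⊕ Fin M.nb) : IsGaussian (M.P.map (M.X i)) :=
  (M.gaussian_cov i).snd.isGaussian_map

instance isGaussian_map_X0 (i : Fin M.na ⊕ Fin M.nb) : IsGaussian (M.P.map (M.X0 i)) :=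
  (M.gaussian_cov i).fst.isGaussian_map

lemma moment_map_X (i : Fin M.na ⊕ Fin M.nb) (k l : Fin M.d) :
    ∫ x, x k * x l ∂(M.P.map (M.X i)) = M.S k l := by
  rw [integral_map (M.measurable_X i).aemeasurable (by fun_prop)]
  exact M.secondMoment_X i k l

lemma moment_map_X0 (i : Fin M.na ⊕ Fin M.nb) (k l : Fin M.d) :
    ∫ x, x k * x l ∂(M.P.map (M.X0 i)) = M.S0 k l := by
  rw [integral_map (M.measurable_X0 i).aemeasurable (by fun_prop)]
  exact M.secondMoment_X0 i k l

lemma measurable_const_dotProduct {m : ℕ} (u : Fin m → ℝ) :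
    Measurable fun x : Fin m → ℝ => u ⬝ᵥ x :=
  measurable_dotProduct (fun _ => measurable_const) fun k => measurable_pi_apply k

lemma integral_dotProduct_sq {m : ℕ} {μ : Measure (Fin m → ℝ)} [IsGaussian μ]
    {S : Matrix (Fin m) (Fin m) ℝ} (hS : ∀ k l, ∫ x, x k * x l ∂μ = S k l) (u : Fin m → ℝ) :
    ∫ x, (u ⬝ᵥ x) ^ 2 ∂μ = u ⬝ᵥ (S *ᵥ u) := by
  have h := integral_quad hS (Matrix.vecMulVec u u)
  rw [Matrix.trace_mul_comm, Matrix.mul_vecMulVec, Matrix.trace_vecMulVec] at h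
  rw [dotProduct_comm, ← h]
  refine integral_congr_ae (Eventually.of_forall fun x => ?_)
  simp only
  rw [Matrix.vecMulVec_mulVec, dotProduct_smul, op_smul_eq_mul, dotProduct_comm x u, pow_two]

lemma integral_dotProduct_X_sq (i : Fin M.na ⊕ Fin M.nb) :
    ∫ ω, (u ⬝ᵥ M.X i ω) ^ 2 ∂M.P = u ⬝ᵥ (M.S *ᵥ u) := by
  rw [← integral_dotProduct_sq (M.moment_map_X i),
    integral_map (M.measurable_X i).aemeasurable]
  exact ((measurable_const_dotProduct u).pow_const 2).aestronglyMeasurable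

lemma integral_dotProduct_X0_sq (i : Fin M.na ⊕ Fin M.nb) :
    ∫ ω, (u ⬝ᵥ M.X0 i ω) ^ 2 ∂M.P = u ⬝ᵥ (M.S0 *ᵥ u) := by
  rw [← integral_dotProduct_sq (M.moment_map_X0 i),
    integral_map (M.measurable_X0 i).aemeasurable]
  exact ((measurable_const_dotProduct u).pow_const 2).aestronglyMeasurable

/-- `X` and `X0` of one unit may be arbitrarily dependent, so the cross term is absorbed by `(a +
b)² ≤ 2a² + 2b²`. -/
lemma integral_lin_sq_le (i : Fin M.na ⊕ Fin M.nb) :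
    ∫ ω, (u ⬝ᵥ M.X i ω + v ⬝ᵥ M.X0 i ω) ^ 2 ∂M.P ≤
      2 * (u ⬝ᵥ (M.S *ᵥ u)) + 2 * (v ⬝ᵥ (M.S0 *ᵥ v)) := by
  have h1 : Integrable (fun ω => (u ⬝ᵥ M.X i ω) ^ 2) M.P := by
    simpa using integrable_pow_of_gaussian (M.hasGaussianLaw_lin u 0 i) 2
  have h2 : Integrable (fun ω => (v ⬝ᵥ M.X0 i ω) ^ 2) M.P := by
    simpa using integrable_pow_of_gaussian (M.hasGaussianLaw_lin 0 v i) 2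
  rw [← M.integral_dotProduct_X_sq u i, ← M.integral_dotProduct_X0_sq v i,
    ← integral_const_mul, ← integral_const_mul, ← integral_add (h1.const_mul 2) (h2.const_mul 2)]
  refine integral_mono (integrable_pow_of_gaussian (M.hasGaussianLaw_lin u v i) 2)
    ((h1.const_mul 2).add (h2.const_mul 2)) fun ω => ?_
  nlinarith [sq_nonneg (u ⬝ᵥ M.X i ω - v ⬝ᵥ M.X0 i ω)]

/-- The prediction error of a linear predictor on one unit. -/
lemma integral_linear_residual_sq (i : Fin M.na ⊕ Fin M.nb) :
    Integrable (fun ω => (u ⬝ᵥ M.X i ω + v ⬝ᵥ M.X0 i ω + g * M.eps0 i ω + h * M.epsBar i ω) ^ 2)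
      M.P ∧
    ∫ ω, (u ⬝ᵥ M.X i ω + v ⬝ᵥ M.X0 i ω + g * M.eps0 i ω + h * M.epsBar i ω) ^ 2 ∂M.P =
      ∫ ω, (u ⬝ᵥ M.X i ω + v ⬝ᵥ M.X0 i ω) ^ 2 ∂M.P + (g ^ 2 + h ^ 2) * σ ^ 2 := by
  set L : M.Ω → ℝ := fun ω => u ⬝ᵥ M.X i ω + v ⬝ᵥ M.X0 i ω with hL
  have hLG : HasGaussianLaw L M.P := M.hasGaussianLaw_lin u v i
  have he0 := (hasLaw_and_iIndepFun_of_pi M.law_eps0).1 i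
  have heb := (hasLaw_and_iIndepFun_of_pi M.law_epsBar).1 i
  have hml : Measurable fun p : Fin M.na ⊕ Fin M.nb → (Fin M.d → ℝ) × (Fin M.d → ℝ) =>
      u ⬝ᵥ (p i).2 + v ⬝ᵥ (p i).1 :=
    ((measurable_const_dotProduct u).comp (g := fun x => u ⬝ᵥ x)
      (measurable_snd.comp (measurable_pi_apply i))).add
    ((measurable_const_dotProduct v).comp (g := fun x => v ⬝ᵥ x)
      (measurable_fst.comp (measurable_pi_apply i)))
  have i1 : IndepFun L (M.eps0 i) M.P := M.indep_cov_noise.comp hml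
    (ψ := fun p : (Fin M.na ⊕ Fin M.nb → ℝ) × (Fin M.na ⊕ Fin M.nb → ℝ) => p.1 i) (by fun_prop)
  have i2 : IndepFun L (M.epsBar i) M.P := M.indep_cov_noise.comp hml
    (ψ := fun p : (Fin M.na ⊕ Fin M.nb → ℝ) × (Fin M.na ⊕ Fin M.nb → ℝ) => p.2 i) (by fun_prop)
  have i3 : IndepFun (M.eps0 i) (M.epsBar i) M.P := M.indep_noise.comp
    (φ := fun p : Fin M.na ⊕ Fin M.nb → ℝ => p i)
    (ψ := fun p : Fin M.na ⊕ Fin M.nb → ℝ => p i) (by fun_prop) (by fun_prop)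
  have l1 := hLG.memLp_two
  have l2 := he0.hasGaussianLaw.memLp_two
  have l3 := heb.hasGaussianLaw.memLp_two
  -- `L` need not be centred; the zero mean of the noise kills every cross term.
  have z1 : ∫ ω, L ω * M.eps0 i ω ∂M.P = 0 := by
    rw [i1.integral_fun_mul_eq_mul_integral l1.1 l2.1, integral_of_hasLaw he0, mul_zero]
  have z2 : ∫ ω, L ω * M.epsBar i ω ∂M.P = 0 := by
    rw [i2.integral_fun_mul_eq_mul_integral l1.1 l3.1, integral_of_hasLaw heb, mul_zero]
  have z3 : ∫ ω, M.eps0 i ω * M.epsBar i ω ∂M.P = 0 := by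
    rw [i3.integral_fun_mul_eq_mul_integral l2.1 l3.1, integral_of_hasLaw heb, mul_zero]
  have q2 := integral_sq_of_hasLaw he0
  have q3 := integral_sq_of_hasLaw heb
  rw [coe_noise_var] at q2 q3
  have e : (fun ω => (L ω + g * M.eps0 i ω + h * M.epsBar i ω) ^ 2) = fun ω =>
      L ω ^ 2 + (g ^ 2 * M.eps0 i ω ^ 2 + (h ^ 2 * M.epsBar i ω ^ 2 +
        (2 * g * (L ω * M.eps0 i ω) + (2 * h * (L ω * M.epsBar i ω) +
          2 * g * h * (M.eps0 i ω * M.epsBar i ω))))) := by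
    funext ω; ring
  have k6 := (l2.integrable_mul l3).const_mul (2 * g * h)
  have k5 := (l1.integrable_mul l3).const_mul (2 * h)
  have k4 := (l1.integrable_mul l2).const_mul (2 * g)
  have k3 := l3.integrable_sq.const_mul (h ^ 2)
  have k2 := l2.integrable_sq.const_mul (g ^ 2)
  have k1 := l1.integrable_sq
  have s5 := k5.add k6
  have s4 := k4.add s5
  have s3 := k3.add s4
  have s2 := k2.add s3
  rw [e]
  refine ⟨k1.add s2, ?_⟩
  refine (integral_add k1 s2).trans (congrArg _ ?_)
  refine (integral_add k2 s3).trans ?_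
  rw [integral_const_mul, q2]
  have t3 := integral_add k3 s4
  have t4 := integral_add k4 s5
  have t5 := integral_add k5 k6
  simp only [integral_const_mul, Pi.mul_apply, Pi.add_apply, q3, z1, z2, z3] at t3 t4 t5 ⊢
  rw [t3, t4, t5]
  ring

end TestUnit

end Model

/-! ### Both losses as losses of a linear predictor. -/

namespace Sample

variable {d n : ℕ}

/-- The mean squared error of a linear predictor, as a function of its coefficient errors. -/
noncomputable def linLoss (u v : Fin d → ℝ) (g h : ℝ) (b : Sample d n) : ℝ :=
  (1 / (n : ℝ)) * ∑ j, (u ⬝ᵥ b.X j + v ⬝ᵥ b.X0 j + g * b.eps0 j + h * b.epsBar j) ^ 2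

lemma measurable_linLoss (u v : Fin d → ℝ) (g h : ℝ) :
    Measurable (linLoss u v g h : Sample d n → ℝ) := by
  refine (Finset.measurable_sum _ fun j _ => Measurable.pow_const ?_ 2).const_mul _
  refine ((Measurable.add ?_ ?_).add (Measurable.const_mul ?_ g)).add (Measurable.const_mul ?_ h)
  · exact (Model.measurable_const_dotProduct u).comp
      ((measurable_pi_apply j).comp (measurable_fst.comp measurable_snd))
  · exact (Model.measurable_const_dotProduct v).comp ((measurable_pi_apply j).comp measurable_fst)
  · exact (measurable_pi_apply j).comp (measurable_fst.comp (measurable_snd.comp measurable_snd))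
  · exact (measurable_pi_apply j).comp (measurable_snd.comp (measurable_snd.comp measurable_snd))

lemma lossStd_eq_linLoss {na : ℕ} (ρ : ℝ) (β : Fin d → ℝ) (a : Sample d na) (b : Sample d n) :
    lossStd ρ β a b = linLoss (β - a.betaHat ρ β) 0 ρ (√(1 - ρ ^ 2)) b := by
  rw [lossStd, linLoss]
  congr 1
  refine Finset.sum_congr rfl fun j _ => ?_
  congr 1
  simp only [Y, eps, Matrix.mulVec, Pi.add_apply, Pi.smul_apply, smul_eq_mul, sub_dotProduct,
    zero_dotProduct, dotProduct_comm (b.X j)]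
  ring

/-- A test residual is `ε₀ - X₀ (β̂₀ - β₀)`. The Stage I error thus enters through `X₀` with factor
`γ`, and `ε₀` is left with coefficient `ρ - γ`. -/
lemma lossAug_eq_linLoss {na : ℕ} (ρ : ℝ) (β0 β : Fin d → ℝ) (a : Sample d na) (b : Sample d n) :
    lossAug ρ β0 β a b = linLoss (β - a.betaHatC ρ β0 β ∘ Sum.inl)
      (a.betaHatC ρ β0 β (Sum.inr ()) • (a.betaHat0 β0 - β0))
      (ρ - a.betaHatC ρ β0 β (Sum.inr ())) (√(1 - ρ ^ 2)) b := by
  rw [lossAug, linLoss]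
  congr 1
  refine Finset.sum_congr rfl fun j _ => ?_
  congr 1
  rw [augDesign, appendCol_mulVec]
  simp only [Y, Y0, eps, Matrix.mulVec, Pi.add_apply, Pi.sub_apply, Pi.smul_apply, smul_eq_mul,
    sub_dotProduct, smul_dotProduct, dotProduct_comm (b.X j), dotProduct_comm (b.X0 j)]
  ring

end Sample

/-! ### Formulas and bounds for the conditional risks. -/

namespace Model

variable {σ ρ : ℝ} (M : Model σ ρ)

lemma integral_linLoss (u v : Fin M.d → ℝ) (g h : ℝ) :
    ∫ ω, Sample.linLoss u v g h (M.test ω) ∂M.P =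
      (1 / (M.nb : ℝ)) * ∑ j : Fin M.nb, (∫ ω, (u ⬝ᵥ M.X (.inr j) ω + v ⬝ᵥ M.X0 (.inr j) ω) ^ 2 ∂M.P +
        (g ^ 2 + h ^ 2) * σ ^ 2) := by
  simp only [Sample.linLoss]
  rw [integral_const_mul]
  congr 1
  refine (integral_finsetSum _ fun j _ =>
    (M.integral_linear_residual_sq u v g h (.inr j)).1).trans ?_
  exact Finset.sum_congr rfl fun j _ => (M.integral_linear_residual_sq u v g h (.inr j)).2

lemma integral_linLoss_zero (u : Fin M.d → ℝ) (g h : ℝ) :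
    ∫ ω, Sample.linLoss u 0 g h (M.test ω) ∂M.P =
      u ⬝ᵥ (M.S *ᵥ u) + (g ^ 2 + h ^ 2) * σ ^ 2 := by
  have : (M.nb : ℝ) ≠ 0 := by exact_mod_cast M.nb_pos.ne'
  rw [integral_linLoss]
  simp only [zero_dotProduct, add_zero, integral_dotProduct_X_sq, Finset.sum_const,
    Finset.card_univ, Fintype.card_fin, nsmul_eq_mul]
  field_simp

lemma integral_linLoss_ge (u v : Fin M.d → ℝ) (g h : ℝ) :
    (g ^ 2 + h ^ 2) * σ ^ 2 ≤ ∫ ω, Sample.linLoss u v g h (M.test ω) ∂M.P := by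
  have hnb : (0 : ℝ) < M.nb := by exact_mod_cast M.nb_pos
  rw [integral_linLoss, one_div, ← div_eq_inv_mul, le_div_iff₀ hnb]
  have : ∑ _j : Fin M.nb, (g ^ 2 + h ^ 2) * σ ^ 2 = (g ^ 2 + h ^ 2) * σ ^ 2 * M.nb := by
    simp [mul_comm]
  rw [← this]
  exact Finset.sum_le_sum fun j _ => le_add_of_nonneg_left (integral_nonneg fun ω => sq_nonneg _)

lemma integral_linLoss_le (u v : Fin M.d → ℝ) (g h : ℝ) :
    ∫ ω, Sample.linLoss u v g h (M.test ω) ∂M.P ≤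
      2 * (u ⬝ᵥ (M.S *ᵥ u)) + 2 * (v ⬝ᵥ (M.S0 *ᵥ v)) + (g ^ 2 + h ^ 2) * σ ^ 2 := by
  have hnb : (0 : ℝ) < M.nb := by exact_mod_cast M.nb_pos
  rw [integral_linLoss, one_div, ← div_eq_inv_mul, div_le_iff₀ hnb]
  have : ∑ _j : Fin M.nb, (2 * (u ⬝ᵥ (M.S *ᵥ u)) + 2 * (v ⬝ᵥ (M.S0 *ᵥ v)) +
      (g ^ 2 + h ^ 2) * σ ^ 2) = (2 * (u ⬝ᵥ (M.S *ᵥ u)) + 2 * (v ⬝ᵥ (M.S0 *ᵥ v)) +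
      (g ^ 2 + h ^ 2) * σ ^ 2) * M.nb := by
    rw [Finset.sum_const, Finset.card_univ, Fintype.card_fin, nsmul_eq_mul, mul_comm]
  rw [← this]
  exact Finset.sum_le_sum fun j _ => by gcongr; exact M.integral_lin_sq_le u v (.inr j)

/-- The noise weights satisfy `ρ² + (1 - ρ²) = 1`. Being an identity, this also gives `σ² ≤ riskStd`
almost surely, the lower bound behind the strict comparison. -/
lemma riskStd_ae (hρ : |ρ| ≤ 1) : ∀ᵐ ω ∂M.P, M.riskStd ω = σ ^ 2 +
    (M.β - (M.train ω).betaHat ρ M.β) ⬝ᵥ (M.S *ᵥ (M.β - (M.train ω).betaHat ρ M.β)) := by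
  have hρ2 : ρ ^ 2 ≤ 1 := by rw [← sq_abs]; exact pow_le_one₀ (abs_nonneg _) hρ
  have h := M.condRisk_ae_eq (loss := Sample.lossStd ρ M.β) fun a => by
    rw [funext (Sample.lossStd_eq_linLoss ρ M.β a)]; exact Sample.measurable_linLoss _ _ _ _
  filter_upwards [h] with ω hω
  rw [riskStd, hω]
  simp only [Sample.lossStd_eq_linLoss]
  rw [integral_linLoss_zero, Real.sq_sqrt (by linarith)]
  ring

/-- The `ε̄` part of the test noise is never predicted, so the excess is nonnegative and only an
upper bound is needed. -/
lemma riskAug_ae (hρ : |ρ| ≤ 1) : ∀ᵐ ω ∂M.P,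
    (1 - ρ ^ 2) * σ ^ 2 ≤ M.riskAug ω ∧
    M.riskAug ω - (1 - ρ ^ 2) * σ ^ 2 ≤
      let c := (M.train ω).betaHatC ρ M.β0 M.β
      σ ^ 2 * (ρ - c (Sum.inr ())) ^ 2 +
      2 * ((M.β - c ∘ Sum.inl) ⬝ᵥ (M.S *ᵥ (M.β - c ∘ Sum.inl))) +
      2 * ((c (Sum.inr ()) • ((M.train ω).betaHat0 M.β0 - M.β0)) ⬝ᵥ
        (M.S0 *ᵥ (c (Sum.inr ()) • ((M.train ω).betaHat0 M.β0 - M.β0)))) := by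
  have hρ2 : ρ ^ 2 ≤ 1 := by rw [← sq_abs]; exact pow_le_one₀ (abs_nonneg _) hρ
  have h := M.condRisk_ae_eq (loss := Sample.lossAug ρ M.β0 M.β) fun a => by
    rw [funext (Sample.lossAug_eq_linLoss ρ M.β0 M.β a)]; exact Sample.measurable_linLoss _ _ _ _
  filter_upwards [h] with ω hω
  rw [riskAug, hω]
  simp only [Sample.lossAug_eq_linLoss]
  have hs : √(1 - ρ ^ 2) ^ 2 = 1 - ρ ^ 2 := Real.sq_sqrt (by linarith)
  set c := (M.train ω).betaHatC ρ M.β0 M.β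
  have h1 := M.integral_linLoss_ge (M.β - c ∘ Sum.inl)
    (c (Sum.inr ()) • ((M.train ω).betaHat0 M.β0 - M.β0)) (ρ - c (Sum.inr ())) (√(1 - ρ ^ 2))
  have h2 := M.integral_linLoss_le (M.β - c ∘ Sum.inl)
    (c (Sum.inr ()) • ((M.train ω).betaHat0 M.β0 - M.β0)) (ρ - c (Sum.inr ())) (√(1 - ρ ^ 2))
  rw [hs] at h1 h2
  constructor
  · nlinarith [mul_nonneg (sq_nonneg (ρ - c (Sum.inr ()))) (sq_nonneg σ)]
  · linarith

/-! The good event has high probability. -/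

lemma measure_gram_bad_le {x : Fin M.na ⊕ Fin M.nb → M.Ω → Fin M.d → ℝ}
    (hx : ∀ i, Measurable (x i)) (hg : ∀ i, IsGaussian (M.P.map (x i)))
    (hind : iIndepFun x M.P) (hid : ∀ i j, IdentDistrib (x i) (x j) M.P M.P)
    {S : Matrix (Fin M.d) (Fin M.d) ℝ} (hS : S.PosDef)
    (hmom : ∀ i k l, ∫ y, y k * y l ∂(M.P.map (x i)) = S k l) {t : ℝ} (ht : 0 < t) :
    M.P.real {ω | ¬ (IsUnit ((Matrix.of fun i : Fin M.na => x (.inl i) ω)ᵀ *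
        Matrix.of fun i : Fin M.na => x (.inl i) ω).det ∧
      (((Matrix.of fun i : Fin M.na => x (.inl i) ω)ᵀ *
        Matrix.of fun i : Fin M.na => x (.inl i) ω)⁻¹ * S).trace ≤ t)} ≤
      4 * (1 + t) / t * (M.d / (M.na + 1)) := by
  -- A test unit always exists, so its law can serve as the common law of the rows.
  set j0 : Fin M.na ⊕ Fin M.nb := .inr ⟨0, M.nb_pos⟩
  set μ := M.P.map (x j0)
  have := hg j0
  have hlaw (i : Fin M.na) : HasLaw (x (.inl i)) μ M.P :=
    ⟨(hx _).aemeasurable, (hid _ _).map_eq⟩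
  have hpi := (hind.precomp Sum.inl_injective).hasLaw_pi hlaw
  refine le_trans ?_ (measure_not_gram_good_le (μ := μ) (n := M.na) hS (hmom j0) ht)
  rw [← hpi.map_eq]
  -- Only the inequality for the image measure is used, so measurability of the event is not
  -- required.
  exact ENNReal.toReal_mono (measure_ne_top _ _) (Measure.le_map_apply hpi.aemeasurable _)

end Model

lemma measurable_compl_entries {α m : Type*} [MeasurableSpace α] [DecidableEq m]
    {A : α → Matrix m m ℝ} (hA : ∀ i j, Measurable fun a => A a i j) (i j : m) :
    Measurable fun a => (1 - A a) i j := by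
  simp only [Matrix.sub_apply]
  exact (hA i j).const_sub _

namespace Model

variable {σ ρ : ℝ} (M : Model σ ρ)

/-- The training covariates. -/
def trainCov (ω : M.Ω) : (Fin M.na → Fin M.d → ℝ) × (Fin M.na → Fin M.d → ℝ) :=
  (fun i => M.X0 (.inl i) ω, fun i => M.X (.inl i) ω)

lemma measurable_trainCov : Measurable M.trainCov := by
  have := M.measurable_X0; have := M.measurable_X
  unfold trainCov
  fun_prop

lemma measurable_train_eps0 : Measurable fun ω => (M.train ω).eps0 :=
  measurable_pi_lambda _ fun i => M.measurable_eps0 (.inl i)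

lemma measurable_train_epsBar : Measurable fun ω => (M.train ω).epsBar :=
  measurable_pi_lambda _ fun i => M.measurable_epsBar (.inl i)

lemma indepFun_trainCov_noise :
    IndepFun M.trainCov (fun ω => ((M.train ω).eps0, (M.train ω).epsBar)) M.P :=
  M.indep_cov_noise.comp
    (φ := fun g : Fin M.na ⊕ Fin M.nb → (Fin M.d → ℝ) × (Fin M.d → ℝ) =>
      ((fun i : Fin M.na => (g (.inl i)).1), (fun i : Fin M.na => (g (.inl i)).2)))
    (ψ := fun g : (Fin M.na ⊕ Fin M.nb → ℝ) × (Fin M.na ⊕ Fin M.nb → ℝ) =>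
      ((fun i : Fin M.na => g.1 (.inl i)), (fun i : Fin M.na => g.2 (.inl i))))
    (by fun_prop) (by fun_prop)

lemma indepFun_train_eps0_epsBar :
    IndepFun (fun ω => (M.train ω).eps0) (fun ω => (M.train ω).epsBar) M.P :=
  M.indep_noise.comp
    (φ := fun (g : Fin M.na ⊕ Fin M.nb → ℝ) (i : Fin M.na) => g (.inl i))
    (ψ := fun (g : Fin M.na ⊕ Fin M.nb → ℝ) (i : Fin M.na) => g (.inl i))
    (by fun_prop) (by fun_prop)

lemma measure_quad_eps0_gt_le
    {A : (Fin M.na → Fin M.d → ℝ) × (Fin M.na → Fin M.d → ℝ) → Matrix (Fin M.na) (Fin M.na) ℝ}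
    (hAm : ∀ i j, Measurable fun w => A w i j) (hA : ∀ w, (A w).PosSemidef) {t s : ℝ} (ht : 0 ≤ t)
    (hs : 0 < s) :
    M.P.real {ω | (A (M.trainCov ω)).trace ≤ t ∧
      s < (M.train ω).eps0 ⬝ᵥ (A (M.trainCov ω) *ᵥ (M.train ω).eps0)} ≤ σ ^ 2 * t / s := by
  refine measure_quad_gt_le M.measurable_trainCov M.measurable_train_eps0
    (M.indepFun_trainCov_noise.comp measurable_id measurable_fst) (sq_nonneg σ)
    (fun i j => integrable_mul_noise M.law_eps0 (.inl i) (.inl j)) (fun i j => ?_) hAm hA ht hs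
  have := integral_mul_noise M.law_eps0 (.inl i) (.inl j)
  rw [coe_noise_var] at this
  simp only [Sum.inl.injEq] at this
  exact this

lemma measure_quad_epsBar_gt_le {𝒲 : Type*} [MeasurableSpace 𝒲] {W : M.Ω → 𝒲} (hW : Measurable W)
    (hind : IndepFun W (fun ω => (M.train ω).epsBar) M.P)
    {A : 𝒲 → Matrix (Fin M.na) (Fin M.na) ℝ}
    (hAm : ∀ i j, Measurable fun w => A w i j) (hA : ∀ w, (A w).PosSemidef) {t s : ℝ} (ht : 0 ≤ t)
    (hs : 0 < s) :
    M.P.real {ω | (A (W ω)).trace ≤ t ∧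
      s < (M.train ω).epsBar ⬝ᵥ (A (W ω) *ᵥ (M.train ω).epsBar)} ≤ σ ^ 2 * t / s := by
  refine measure_quad_gt_le hW M.measurable_train_epsBar hind (sq_nonneg σ)
    (fun i j => integrable_mul_noise M.law_epsBar (.inl i) (.inl j)) (fun i j => ?_) hAm hA ht hs
  have := integral_mul_noise M.law_epsBar (.inl i) (.inl j)
  rw [coe_noise_var] at this
  simp only [Sum.inl.injEq] at this
  exact this

/-- The matrix of the quadratic form giving the squared correlation with the orthogonalized
residuals. -/
noncomputable def crossMatrix {d n : ℕ}
    (w : ((Fin n → Fin d → ℝ) × (Fin n → Fin d → ℝ)) × (Fin n → ℝ)) : Matrix (Fin n) (Fin n) ℝ :=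
  let r := Sample.orthResid ((w.1.1, w.1.2, w.2, 0) : Sample d n)
  (r ⬝ᵥ r)⁻¹ • Matrix.vecMulVec r r

lemma measurable_crossMatrix {d n : ℕ} (i j : Fin n) :
    Measurable fun w : ((Fin n → Fin d → ℝ) × (Fin n → Fin d → ℝ)) × (Fin n → ℝ) =>
      crossMatrix w i j := by
  have h0 : ∀ i j, Measurable fun w : ((Fin n → Fin d → ℝ) × (Fin n → Fin d → ℝ)) × (Fin n → ℝ) =>
      Matrix.of w.1.1 i j := fun i j => by simp only [Matrix.of_apply]; fun_prop
  have h1 : ∀ i j, Measurable fun w : ((Fin n → Fin d → ℝ) × (Fin n → Fin d → ℝ)) × (Fin n → ℝ) =>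
      Matrix.of w.1.2 i j := fun i j => by simp only [Matrix.of_apply]; fun_prop
  have hr : ∀ i, Measurable fun w : ((Fin n → Fin d → ℝ) × (Fin n → Fin d → ℝ)) × (Fin n → ℝ) =>
      Sample.orthResid ((w.1.1, w.1.2, w.2, 0) : Sample d n) i :=
    measurable_mulVec_entries (measurable_compl_entries (measurable_hat_entries h1))
      (measurable_mulVec_entries (measurable_compl_entries (measurable_hat_entries h0))
        fun i => (measurable_pi_apply i).comp measurable_snd)
  exact (measurable_dotProduct hr hr).inv.mul ((hr i).mul (hr j))

lemma posSemidef_crossMatrix {d n : ℕ}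
    (w : ((Fin n → Fin d → ℝ) × (Fin n → Fin d → ℝ)) × (Fin n → ℝ)) :
    (crossMatrix w).PosSemidef := by
  refine Matrix.PosSemidef.smul ?_ (inv_nonneg.2 (dotProduct_self_nonneg _))
  simpa using Matrix.posSemidef_vecMulVec_self_star
    (Sample.orthResid ((w.1.1, w.1.2, w.2, 0) : Sample d n))

/-- The matrix projects onto the line spanned by `orthResid`, or is `0` if that vector vanishes.
Rank one is why the correlation with `ε̄` costs `C` rather than `C d`. -/
lemma trace_crossMatrix_le {d n : ℕ}
    (w : ((Fin n → Fin d → ℝ) × (Fin n → Fin d → ℝ)) × (Fin n → ℝ)) :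
    (crossMatrix w).trace ≤ 1 := by
  rw [crossMatrix, Matrix.trace_smul, Matrix.trace_vecMulVec, smul_eq_mul]
  exact inv_mul_le_one

/-- The good event has probability close to one when `n_a ≫ d`. -/
lemma measure_not_good_le (hσ : 0 < σ) {η : ℝ} (hη : 0 < η)
    (hK : 8 / η ≤ (M.na : ℝ) / M.d) :
    M.P.real {ω | ¬ (M.train ω).Good σ (σ ^ 2 * (8 / η + 1) / η) M.S0 M.S} ≤ 10 * η := by
  have hd : (0 : ℝ) < M.d := by exact_mod_cast M.d_pos
  have hd1 : (1 : ℝ) ≤ M.d := by exact_mod_cast M.d_pos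
  have hn : (0 : ℝ) < M.na := by
    have : (0 : ℝ) < M.na / M.d := lt_of_lt_of_le (by positivity) hK
    exact (div_pos_iff_of_pos_right hd).1 this
  have hn0 : 0 < M.na := by exact_mod_cast hn
  have hx : (M.d : ℝ) / M.na ≤ η / 8 := by
    have := one_div_le_one_div_of_le (by positivity) hK
    simpa using this
  set x : ℝ := (M.d : ℝ) / M.na with hxdef
  have hx0 : 0 < x := by positivity
  set C : ℝ := σ ^ 2 * (8 / η + 1) / η with hC
  have hC0 : 0 < C := by positivity
  -- This `t` makes the Gram bound at most `η/2 + 4x ≤ η`. The constant `C` then gives `σ² t / (C x)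
  -- = η · (8/η) / (8/η + 1) ≤ η` and also `σ² / C ≤ η`.
  set t : ℝ := 8 / η * x with ht
  have ht0 : 0 < t := by positivity
  -- probability bounds
  have hgram : 4 * (1 + t) / t * ((M.d : ℝ) / (M.na + 1)) ≤ η := by
    have e1 : (M.d : ℝ) / (M.na + 1) ≤ x := by rw [hxdef]; gcongr; linarith
    have e2 : 4 * (1 + t) / t * x = η / 2 + 4 * x := by rw [ht]; field_simp; ring
    refine (mul_le_mul_of_nonneg_left e1 (by positivity)).trans ?_
    rw [e2]; linarith
  have hcoef : σ ^ 2 * t / (C * x) ≤ η := by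
    rw [div_le_iff₀ (by positivity), ht, hC]
    have : η * (σ ^ 2 * (8 / η + 1) / η * x) = σ ^ 2 * (8 / η * x) + σ ^ 2 * x := by field_simp
    rw [this]
    have : 0 ≤ σ ^ 2 * x := by positivity
    linarith
  have hC1 : σ ^ 2 / η ≤ C := by
    rw [hC]; gcongr
    have : 0 ≤ σ ^ 2 * (8 / η) := by positivity
    linarith
  have hhat : σ ^ 2 * M.d / (C * M.d) ≤ η := by
    rw [mul_div_mul_right _ _ hd.ne', div_le_iff₀ hC0, mul_comm]
    exact (div_le_iff₀ hη).1 hC1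
  have hcross : σ ^ 2 * 1 / C ≤ η := by
    rw [mul_one, div_le_iff₀ hC0, mul_comm]
    exact (div_le_iff₀ hη).1 hC1
  have hnorm : (8 : ℝ) / M.na ≤ η := by
    have : (8 : ℝ) / M.na = 8 * (1 / M.na) := by ring
    have h2 : 1 / (M.na : ℝ) ≤ x := by rw [hxdef]; gcongr
    linarith
  -- measurability
  have m0 : ∀ i j, Measurable fun w : (Fin M.na → Fin M.d → ℝ) × (Fin M.na → Fin M.d → ℝ) =>
      Matrix.of w.1 i j := fun i j => by simp only [Matrix.of_apply]; fun_prop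
  have m1 : ∀ i j, Measurable fun w : (Fin M.na → Fin M.d → ℝ) × (Fin M.na → Fin M.d → ℝ) =>
      Matrix.of w.2 i j := fun i j => by simp only [Matrix.of_apply]; fun_prop
  have mH0 := measurable_hat_entries m0
  have mH := measurable_hat_entries m1
  have mL : ∀ i j, Measurable fun w : (Fin M.na → Fin M.d → ℝ) × (Fin M.na → Fin M.d → ℝ) =>
      ((lsq (Matrix.of w.2))ᵀ * M.S * lsq (Matrix.of w.2)) i j :=
    measurable_mul_entries (measurable_mul_entries (fun i j => measurable_lsq_entries m1 j i)
      fun _ _ => measurable_const) (measurable_lsq_entries m1)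
  have mL0 : ∀ i j, Measurable fun w : (Fin M.na → Fin M.d → ℝ) × (Fin M.na → Fin M.d → ℝ) =>
      ((lsq (Matrix.of w.1))ᵀ * M.S0 * lsq (Matrix.of w.1)) i j :=
    measurable_mul_entries (measurable_mul_entries (fun i j => measurable_lsq_entries m0 j i)
      fun _ _ => measurable_const) (measurable_lsq_entries m0)
  have mHr := measurable_mul_entries (measurable_mul_entries (measurable_compl_entries mH0) mH)
    (measurable_compl_entries mH0)
  have mLr := measurable_mul_entries (measurable_mul_entries (measurable_compl_entries mH0) mL)
    (measurable_compl_entries mH0)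
  -- the bad events
  have b1 := (M.measure_gram_bad_le M.measurable_X0 M.isGaussian_map_X0
    (M.indep_cov.comp (fun _ => Prod.fst) fun _ => measurable_fst)
    (fun i j => (M.identDistrib_cov i j).comp measurable_fst) M.posDef_S0 M.moment_map_X0
    ht0).trans hgram
  have b2 := (M.measure_gram_bad_le M.measurable_X M.isGaussian_map_X
    (M.indep_cov.comp (fun _ => Prod.snd) fun _ => measurable_snd)
    (fun i j => (M.identDistrib_cov i j).comp measurable_snd) M.posDef_S M.moment_map_X
    ht0).trans hgram
  have b3 := (measure_sum_sq_lt_le (P := M.P) hn0 (v := (σ ^ 2).toNNReal)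
    (by simpa using pow_pos hσ 2)
    (fun i : Fin M.na => (hasLaw_and_iIndepFun_of_pi M.law_eps0).1 (.inl i))
    ((hasLaw_and_iIndepFun_of_pi M.law_eps0).2.precomp Sum.inl_injective)).trans hnorm
  rw [coe_noise_var] at b3
  have b4 := (M.measure_quad_eps0_gt_le mH0 (fun w => posSemidef_hat _) hd.le
    (mul_pos hC0 hd)).trans hhat
  have b5 := (M.measure_quad_eps0_gt_le mHr
    (fun w => posSemidef_compl_conj (posSemidef_hat _) (hat_transpose _)) hd.le
    (mul_pos hC0 hd)).trans hhat
  have b6 := (M.measure_quad_eps0_gt_le mL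
    (fun w => posSemidef_lsq_conj M.posDef_S.posSemidef _) ht0.le (mul_pos hC0 hx0)).trans hcoef
  have b7 := (M.measure_quad_epsBar_gt_le M.measurable_trainCov
    (M.indepFun_trainCov_noise.comp measurable_id measurable_snd) mL
    (fun w => posSemidef_lsq_conj M.posDef_S.posSemidef _) ht0.le (mul_pos hC0 hx0)).trans hcoef
  have b8 := (M.measure_quad_eps0_gt_le mLr
    (fun w => posSemidef_compl_conj (posSemidef_lsq_conj M.posDef_S.posSemidef _)
      (hat_transpose _)) ht0.le (mul_pos hC0 hx0)).trans hcoef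
  have b9 := (M.measure_quad_eps0_gt_le mL0
    (fun w => posSemidef_lsq_conj M.posDef_S0.posSemidef _) ht0.le (mul_pos hC0 hx0)).trans hcoef
  have b10 := (M.measure_quad_epsBar_gt_le
    (M.measurable_trainCov.prodMk M.measurable_train_eps0)
    (indepFun_prodMk_left M.measurable_trainCov M.measurable_train_eps0 M.measurable_train_epsBar
      M.indepFun_trainCov_noise M.indepFun_train_eps0_epsBar) measurable_crossMatrix
    posSemidef_crossMatrix zero_le_one hC0).trans hcross
  have hu {A B : Set M.Ω} {p q : ℝ} (hA : M.P.real A ≤ p) (hB : M.P.real B ≤ q) :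
      M.P.real (A ∪ B) ≤ p + q := (measureReal_union_le A B).trans (add_le_add hA hB)
  have hall := hu (hu (hu (hu (hu (hu (hu (hu (hu b1 b2) b3) b4) b5) b6) b7) b8) b9) b10
  refine (measureReal_mono ?_).trans (hall.trans (by linarith))
  intro ω hω
  by_contra hnot
  simp only [Set.mem_union, not_or] at hnot
  obtain ⟨⟨⟨⟨⟨⟨⟨⟨⟨h0, h1⟩, g3⟩, g4⟩, g5⟩, g6⟩, g7⟩, g8⟩, g9⟩, g10⟩ := hnot
  simp only [Set.mem_ofPred_eq, not_not] at h0 h1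
  simp only [Set.mem_ofPred_eq, not_and, not_lt] at g3 g4 g5 g6 g7 g8 g9 g10
  obtain ⟨u0, t0⟩ := h0
  obtain ⟨u1, t1⟩ := h1
  -- Each quadratic-form bound is conditional on a trace bound: at most `d` by rank for the hat
  -- matrices, at most `t` by the Gram events for the coefficient errors.
  have tH0 : (hat (M.train ω).X0).trace ≤ M.d := by simpa using trace_hat_le (M.train ω).X0
  have tH : (hat (M.train ω).X).trace ≤ M.d := by simpa using trace_hat_le (M.train ω).X
  have tL : ((lsq (M.train ω).X)ᵀ * M.S * lsq (M.train ω).X).trace ≤ t := by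
    rw [trace_lsq_conj]; exact t1
  have tL0 : ((lsq (M.train ω).X0)ᵀ * M.S0 * lsq (M.train ω).X0).trace ≤ t := by
    rw [trace_lsq_conj]; exact t0
  have hS := posSemidef_lsq_conj M.posDef_S.posSemidef (M.train ω).X
  exact hω
    { isUnit_X0 := u0
      isUnit_X := u1
      norm_eps0 := g3
      hat_eps0 := g4 tH0
      hat_resid := g5 ((trace_compl_conj_le (posSemidef_hat _) (hat_transpose _)
        (hat_mul_hat _)).trans tH)
      coef_eps0 := g6 tL
      coef_epsBar := g7 tL
      coef_resid := g8 ((trace_compl_conj_le hS (hat_transpose _) (hat_mul_hat _)).trans tL)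
      coef0_eps0 := g9 tL0
      cross := g10 (trace_crossMatrix_le _) }

/-- On the good event both excess risks are of order `d / n_a`. -/
lemma risk_bounds_of_good (hσ : 0 < σ) (hρ : |ρ| ≤ 1) {C : ℝ} (hC : 0 ≤ C) (hn : 0 < M.na)
    (hK : 24 * C / σ ^ 2 ≤ (M.na : ℝ) / M.d) :
    ∀ᵐ ω ∂M.P, (M.train ω).Good σ C M.S0 M.S →
      |M.riskAug ω - (1 - ρ ^ 2) * σ ^ 2| ≤ 100 * C * ((M.d : ℝ) / M.na) ∧
      |M.riskStd ω - σ ^ 2| ≤ 4 * C * ((M.d : ℝ) / M.na) ∧ σ ^ 2 ≤ M.riskStd ω := by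
  have hd : (0 : ℝ) < M.d := by exact_mod_cast M.d_pos
  have hK' : 24 * C * M.d ≤ M.na * σ ^ 2 := by
    rwa [div_le_div_iff₀ (by positivity) hd] at hK
  filter_upwards [M.riskStd_ae hρ, M.riskAug_ae hρ] with ω hstd haug hg
  have h1 := hg.std_excess_le M.posDef_S.posSemidef hρ hC M.β
  have h2 := hg.aug_excess_le M.posDef_S.posSemidef hσ hρ hC M.d_pos hn hK' M.β0 M.β
  have h3 : 0 ≤ (M.β - (M.train ω).betaHat ρ M.β) ⬝ᵥ
      (M.S *ᵥ (M.β - (M.train ω).betaHat ρ M.β)) := by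
    simpa using M.posDef_S.posSemidef.dotProduct_mulVec_nonneg (M.β - (M.train ω).betaHat ρ M.β)
  refine ⟨?_, ?_, by linarith⟩
  · rw [abs_of_nonneg (by linarith [haug.1])]
    exact haug.2.trans h2
  · rw [hstd, add_sub_cancel_left, abs_of_nonneg h3]
    exact h1

lemma eventually_le_ratio (K : ℝ) :
    ∀ᶠ M : Model σ ρ in manySamples σ ρ, K ≤ (M.na : ℝ) / M.d :=
  tendsto_comap.eventually (eventually_ge_atTop _)

/-- Uniform high-probability bounds for both risks. -/
lemma exists_forall_measure_le (hσ : 0 < σ) (hρ : |ρ| ≤ 1) {δ : ℝ} (hδ : 0 < δ) :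
    ∃ C : ℝ, 0 ≤ C ∧ ∀ᶠ M : Model σ ρ in manySamples σ ρ,
      M.P.real {ω | ¬ (|M.riskAug ω - (1 - ρ ^ 2) * σ ^ 2| ≤ C * ((M.d : ℝ) / M.na) ∧
        |M.riskStd ω - σ ^ 2| ≤ C * ((M.d : ℝ) / M.na) ∧ σ ^ 2 ≤ M.riskStd ω)} ≤ δ := by
  set η := δ / 10 with hη
  have hη0 : 0 < η := by positivity
  set C := σ ^ 2 * (8 / η + 1) / η with hC
  have hC0 : 0 < C := by positivity
  refine ⟨100 * C, by positivity, ?_⟩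
  -- The first threshold makes the good event likely; the second is the condition `24 C d ≤ n σ²` of
  -- the deterministic bounds.
  filter_upwards [eventually_le_ratio (max (8 / η) (24 * C / σ ^ 2))] with M hM
  have hd : (0 : ℝ) < M.d := by exact_mod_cast M.d_pos
  have hn : 0 < M.na := by
    have : (0 : ℝ) < M.na / M.d :=
      lt_of_lt_of_le (by positivity) ((le_max_left _ _).trans hM)
    exact_mod_cast (div_pos_iff_of_pos_right hd).1 this
  have h1 := M.measure_not_good_le hσ hη0 ((le_max_left _ _).trans hM)
  have h2 := M.risk_bounds_of_good hσ hρ hC0.le hn ((le_max_right _ _).trans hM)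
  refine le_trans ?_ (h1.trans_eq (by rw [hη]; ring))
  refine ENNReal.toReal_mono (measure_ne_top _ _) (measure_mono_ae ?_)
  filter_upwards [h2] with ω hω hbad hgood
  obtain ⟨k1, k2, k3⟩ := hω hgood
  have : 0 ≤ C * ((M.d : ℝ) / M.na) := by positivity
  exact hbad ⟨k1, k2.trans (by linarith), k3⟩

end Model

end LinearRecourse

theorem mainTheorem2 (σ ρ : ℝ) (hσ : 0 < σ) (hρ : |ρ| ≤ 1) :
    LinearRecourse.IsBigOp (LinearRecourse.Model.manySamples σ ρ) (fun M => M.P)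
        (fun M ω => M.riskAug ω - (1 - ρ ^ 2) * σ ^ 2)
        (fun M => √((M.d : ℝ) / (M.na : ℝ))) ∧
      LinearRecourse.IsBigOp (LinearRecourse.Model.manySamples σ ρ) (fun M => M.P)
        (fun M ω => M.riskStd ω - σ ^ 2)
        (fun M => (M.d : ℝ) / (M.na : ℝ)) ∧
      (ρ ≠ 0 →
        Tendsto (fun M : LinearRecourse.Model σ ρ => M.P.real {ω | M.riskAug ω < M.riskStd ω})
          (LinearRecourse.Model.manySamples σ ρ) (𝓝 1)) := by
  refine ⟨fun δ hδ => ?_, fun δ hδ => ?_, fun hρ0 => ?_⟩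
  · obtain ⟨C, hC0, hC⟩ := LinearRecourse.Model.exists_forall_measure_le hσ hρ hδ
    refine ⟨C, ?_⟩
    filter_upwards [hC, LinearRecourse.Model.eventually_le_ratio 1] with M hM hM1
    refine (measureReal_mono fun ω hω hgood => ?_).trans hM
    have hx : (M.d : ℝ) / M.na ≤ 1 := by
      have := one_div_le_one_div_of_le one_pos hM1
      simpa using this
    -- The bound obtained is of order `d / n_a`, which its square root dominates once the ratio is
    -- at most one.
    have : (M.d : ℝ) / M.na ≤ √((M.d : ℝ) / M.na) :=
      Real.le_sqrt_of_sq_le (by nlinarith [show (0 : ℝ) ≤ M.d / M.na by positivity])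
    exact absurd (hgood.1.trans (mul_le_mul_of_nonneg_left this hC0)) (not_le.2 hω)
  · obtain ⟨C, hC0, hC⟩ := LinearRecourse.Model.exists_forall_measure_le hσ hρ hδ
    refine ⟨C, ?_⟩
    filter_upwards [hC] with M hM
    exact (measureReal_mono fun ω hω hgood => absurd hgood.2.1 (not_le.2 hω)).trans hM
  · rw [tendsto_order]
    refine ⟨fun a ha => ?_, fun a ha => Eventually.of_forall fun M => measureReal_le_one.trans_lt ha⟩
    obtain ⟨C, hC0, hC⟩ := LinearRecourse.Model.exists_forall_measure_le (δ := (1 - a) / 2) hσ hρ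
      (by linarith)
    have hρσ : 0 < ρ ^ 2 * σ ^ 2 := by positivity
    -- The two-stage risk lies below `σ²` as soon as `C d / n_a` is below the gap `ρ²σ²`; `C + 1`
    -- instead of `C` makes this strict, also for `C = 0`.
    filter_upwards [LinearRecourse.Model.eventually_le_ratio ((C + 1) / (ρ ^ 2 * σ ^ 2)), hC] with M hM1 hM
    have hx : C * ((M.d : ℝ) / M.na) < ρ ^ 2 * σ ^ 2 := by
      have h1 := one_div_le_one_div_of_le (by positivity) hM1
      rw [one_div_div, one_div_div, le_div_iff₀ (by positivity)] at h1
      have hn : (0 : ℝ) < (M.na : ℝ) / M.d := lt_of_lt_of_le (by positivity) hM1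
      have : (0 : ℝ) < (M.d : ℝ) / M.na := by rw [← one_div_div]; positivity
      linarith
    have hcompl : {ω | M.riskAug ω < M.riskStd ω}ᶜ ⊆
        {ω | ¬ (|M.riskAug ω - (1 - ρ ^ 2) * σ ^ 2| ≤ C * ((M.d : ℝ) / M.na) ∧
        |M.riskStd ω - σ ^ 2| ≤ C * ((M.d : ℝ) / M.na) ∧ σ ^ 2 ≤ M.riskStd ω)} := by
      intro ω hω hgood
      refine hω ?_
      have := (abs_le.1 hgood.1).2
      have := hgood.2.2
      change M.riskAug ω < M.riskStd ω
      linarith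
    -- Subadditivity suffices here, so measurability of the comparison event is not needed.
    have h1 : (1 : ℝ) ≤ M.P.real {ω | M.riskAug ω < M.riskStd ω} +
        M.P.real {ω | M.riskAug ω < M.riskStd ω}ᶜ := by
      have := measureReal_union_le (μ := M.P) {ω | M.riskAug ω < M.riskStd ω}
        {ω | M.riskAug ω < M.riskStd ω}ᶜ
      rwa [Set.union_compl_self, probReal_univ] at this
    have h2 := (measureReal_mono hcompl).trans hM
    linarith
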